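/- Let $N\ge 0$, $m\ge 1$ be integers and $\mathbb T^N=\mathbb R^N/\mathbb Z^N$ the flat torus. For $1\le i\le m$ let $H_i:\mathbb T^N\times\mathbb R^N\to\mathbb R$ be continuous, convex in $p\in\mathbb R^N$, and such that $\alpha_i(|p|)\le H_i(x,p)\le\beta_i(|p|)$ for all $(x,p)$, for some functions $\alpha_i,\beta_i:[0,\infty)\to\mathbb R$ tending to $+\infty$ at $+\infty$. Let $B(x)=(b_{ij}(x))$ be an $m\times m$ real matrix depending continuously on $x\in\mathbb T^N$ such that, for every $x$: $b_{ij}(x)\le 0$ for $j\ne i$; $\sum_{j}b_{ij}(x)=0$ for every $i$; and for every nonempty proper subset $I$ of $\{1,\dots,m\}$ there are $i\in I$, $j\notin I$ with $b_{ij}(x)\neq 0$. For $a\in\mathbb R$ let $\mathcal H(a)$ be the set of $\mathbf u=(u_1,\dots,u_m)\in C(\mathbb T^N)^m$ that are viscosity subsolutions of $$H_i(x,Du_i)+(B(x)\mathbf u(x))_i=a\quad\text{in }\mathbb T^N,\qquad i=1,\dots,m,$$ i.e. $H_i(x,p)+(B(x)\mathbf u(x))_i\le a$ for all $x$, all $i$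 and all $p$ in the superdifferential $D^+u_i(x)$; supersolutions are defined with $\ge$ and the subdifferential $D^-u_i(x)$, and a solution is both a sub- and a supersolution. Here $D^+f(x)$ (resp. $D^-f(x)$) is the set of gradients $D\varphi(x)$ of functions $\varphi$ that are $C^1$ near $x$ and such that $f-\varphi$ has a local maximum (resp. minimum) at $x$. Assume that the critical value $c=\inf\{a\in\mathbb R:\mathcal H(a)\ne\varnothing\}$ equals $0$. Critical subsolutions (solutions) are the subsolutions (solutions) of the system with $a=0$. Put $$\Phi_{i,j}(y,x)=\sup_{\mathbf v\in\mathcal H(0)}\big(v_i(x)-v_j(y)\big),$$ and let the Aubry set be $\mathcal A=\{y\in\mathbb T^N:\ (\Phi_{1,k}(y,\cdot),\dots,\Phi_{m,k}(y,\cdot))\text{ is a critical solution}\}$, where $k$ is any fixed index in $\{1,\dots,m\}$. A critical subsolution $\mathbf v$ is strict in a set $U$ if for every $y\in U$ and every $i$ there are an open neighbourhood $V$ of $y$ and $\delta>0$ such that $H_i(x,Dv_i(x))+(B(x)\mathbf v(x))_i<-\delta$ for a.e. $x\in V$ (in particular $v_i$ is differentiable at a.e. $x\in V$). Let $\|\mathbf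 u\|_\infty=\max_i\max_{\mathbb T^N}|u_i|$. Then there exists a critical subsolution that is strict and $C^\infty$ in $\mathbb T^N\setminus\mathcal A$. More precisely, for every critical subsolution $\mathbf v$ that is strict in $\mathbb T^N\setminus\mathcal A$ and every $\varepsilon>0$ there is a critical subsolution $\mathbf v^\varepsilon$ such that (i) $\|\mathbf v^\varepsilon-\mathbf v\|_\infty<\varepsilon$; (ii) $\mathbf v^\varepsilon=\mathbf v$ on $\mathcal A$; (iii) $\mathbf v^\varepsilon$ is $C^\infty$ and strict in $\mathbb T^N\setminus\mathcal A$. Moreover, the set of critical subsolutions that are $C^\infty$ and strict in $\mathbb T^N\setminus\mathcal A$ is dense in $\mathcal H(0)$ with respect to $\|\cdot\|_\infty$. -/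

import Mathlib

open scoped ContDiff Topology

noncomputable section

namespace WeaklyCoupled

/-- The Euclidean space `ℝ^N`. -/
abbrev Eucl (N : ℕ) : Type := EuclideanSpace ℝ (Fin N)

/-- The flat torus `𝕋^N = ℝ^N / ℤ^N`. -/
abbrev Torus (N : ℕ) : Type := UnitAddTorus (Fin N)

/-- The canonical projection `ℝ^N → 𝕋^N`. Differential notions for functions on the torus are those
of their (periodic) lifts to `ℝ^N`. -/
def proj {N : ℕ} (x : Eucl N) : Torus N := fun l => ((x l : ℝ) : UnitAddCircle)

/-! ### Coupling matrices -/

/-- Off-diagonal entries are nonpositive, and row sums are nonnegative. -/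
def IsCoupling {m : ℕ} (M : Matrix (Fin m) (Fin m) ℝ) : Prop :=
  (∀ i j, j ≠ i → M i j ≤ 0) ∧ ∀ i, 0 ≤ ∑ j, M i j

/-- All row sums vanish. -/
def IsDegenerate {m : ℕ} (M : Matrix (Fin m) (Fin m) ℝ) : Prop :=
  ∀ i, ∑ j, M i j = 0

/-- For every nonempty proper subset `I` of the indices there are `i ∈ I` and `j ∉ I` with
`M i j ≠ 0`. -/
def IsIrreducible {m : ℕ} (M : Matrix (Fin m) (Fin m) ℝ) : Prop :=
  ∀ I : Set (Fin m), I.Nonempty → I ≠ Set.univ → ∃ i ∈ I, ∃ j ∉ I, M i j ≠ 0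

/-! ### Hamiltonians -/

/-- A convex Hamiltonian on `𝕋^N × ℝ^N`: continuous, convex in the momentum, and bounded below and
above by coercive functions of the norm of the momentum. -/
structure IsConvexHamiltonian {N : ℕ} (h : Torus N → Eucl N → ℝ) : Prop where
  continuous : Continuous fun z : Torus N × Eucl N => h z.1 z.2
  convex : ∀ x, ConvexOn ℝ Set.univ (h x)
  coercive : ∃ α β : NNReal → ℝ,
    Filter.Tendsto α Filter.atTop Filter.atTop ∧ Filter.Tendsto β Filter.atTop Filter.atTop ∧
      ∀ x p, α ‖p‖₊ ≤ h x p ∧ h x p ≤ β ‖p‖₊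

/-! ### Viscosity sub- and supersolutions -/

/-- `D⁺f(x)`: gradients at `x` of functions `φ`, of class `C^1` near `x`, such that `f - φ` has a
local maximum at `x`. -/
def superdifferential {N : ℕ} (f : Eucl N → ℝ) (x : Eucl N) : Set (Eucl N) :=
  {p | ∃ φ : Eucl N → ℝ, ContDiffAt ℝ 1 φ x ∧ IsLocalMax (fun z => f z - φ z) x ∧
    HasGradientAt φ p x}

/-- `D⁻f(x)`: gradients at `x` of functions `φ`, of class `C^1` near `x`, such that `f - φ` has a
local minimum at `x`. -/
def subdifferential {N : ℕ} (f : Eucl N → ℝ) (x : Eucl N) : Set (Eucl N) :=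
  {p | ∃ φ : Eucl N → ℝ, ContDiffAt ℝ 1 φ x ∧ IsLocalMin (fun z => f z - φ z) x ∧
    HasGradientAt φ p x}

/-- The `i`-th component of a vector-valued function on the torus, lifted to `ℝ^N`. -/
def liftComp {N m : ℕ} (u : Torus N → Fin m → ℝ) (i : Fin m) : Eucl N → ℝ :=
  fun x => u (proj x) i

section System

variable {N m : ℕ} (H : Fin m → Torus N → Eucl N → ℝ)
  (B : Torus N → Matrix (Fin m) (Fin m) ℝ)

/-- The left-hand side `H_i(x,p) + (B(x)u(x))_i` of the system. -/
def lhs (u : Torus N → Fin m → ℝ) (i : Fin m) (x : Torus N) (p : Eucl N) : ℝ :=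
  H i x p + (B x).mulVec (u x) i

/-- Continuous viscosity subsolutions of `H_i(x,Du_i) + (B(x)u(x))_i = a_i` on the torus. -/
def IsSubsolution (a : Fin m → ℝ) (u : Torus N → Fin m → ℝ) : Prop :=
  Continuous u ∧ ∀ (i : Fin m) (x : Eucl N), ∀ p ∈ superdifferential (liftComp u i) x,
    lhs H B u i (proj x) p ≤ a i

/-- Continuous viscosity supersolutions of `H_i(x,Du_i) + (B(x)u(x))_i = a_i` on the torus. -/
def IsSupersolution (a : Fin m → ℝ) (u : Torus N → Fin m → ℝ) : Prop :=
  Continuous u ∧ ∀ (i : Fin m) (x : Eucl N), ∀ p ∈ subdifferential (liftComp u i) x,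
    a i ≤ lhs H B u i (proj x) p

/-- Viscosity solutions. -/
def IsSolution (a : Fin m → ℝ) (u : Torus N → Fin m → ℝ) : Prop :=
  IsSubsolution H B a u ∧ IsSupersolution H B a u

/-- The set `ℋ(a)` of subsolutions, as a subset of the Banach space `C(𝕋^N)^m`, whose norm is the
maximum over the components of their sup norms. -/
def subsolutions (a : Fin m → ℝ) : Set C(Torus N, Fin m → ℝ) :=
  {u | IsSubsolution H B a u}

/-- `c` is the critical value: the infimum of the `a ∈ ℝ` such that `ℋ(a,…,a)` is nonempty. -/
def IsCriticalValue (c : ℝ) : Prop :=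
  IsGLB {a : ℝ | (subsolutions H B fun _ => a).Nonempty} c

/-- The set `ℋ(0)` of critical subsolutions of a system with critical value `0`. -/
def criticalSubsolutions : Set C(Torus N, Fin m → ℝ) :=
  subsolutions H B fun _ => 0

/-- The Mañé matrix `Φ_{i,j}(y,x) = sup {v_i(x) - v_j(y) : v ∈ ℋ(0)}`. -/
def mane (i j : Fin m) (y x : Torus N) : ℝ :=
  ⨆ v : criticalSubsolutions H B, (v.1 x i - v.1 y j)

/-- The Aubry set: points `y` such that `Φ_{·,k}(y,·)` is a critical solution, where `k` is a fixed
index. -/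
def aubrySet (k : Fin m) : Set (Torus N) :=
  {y | IsSolution H B (fun _ => 0) fun x i => mane H B i k y x}

/-- `v_i` is strict at `y`: for some `δ > 0` and some open neighbourhood `V` of `y`, at almost every
point of `V` the function `v_i` is differentiable with
`H_i(x,Dv_i(x)) + (B(x)v(x))_i < -δ`. (A subset of the torus is negligible if and only if its
preimage in `ℝ^N` is.) -/
def IsStrictCompAt (v : Torus N → Fin m → ℝ) (i : Fin m) (y : Torus N) : Prop :=
  ∃ V : Set (Torus N), IsOpen V ∧ y ∈ V ∧ ∃ δ : ℝ, 0 < δ ∧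
    ∀ᵐ x : Eucl N, proj x ∈ V →
      ∃ p : Eucl N, HasGradientAt (liftComp v i) p x ∧ lhs H B v i (proj x) p < -δ

/-- `v` is strict in `U`: every component is strict at every point of `U`. -/
def IsStrictIn (v : Torus N → Fin m → ℝ) (U : Set (Torus N)) : Prop :=
  ∀ y ∈ U, ∀ i, IsStrictCompAt H B v i y

end System

/-- `v` is of class `C^∞` in the (open) subset `U` of the torus. -/
def IsSmoothIn {N m : ℕ} (v : Torus N → Fin m → ℝ) (U : Set (Torus N)) : Prop :=
  ∀ x : Eucl N, proj x ∈ U → ∀ i, ContDiffAt ℝ ∞ (liftComp v i) x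

end WeaklyCoupled

end

open scoped ContDiff Topology Convolution

namespace WeaklyCoupled

open Filter Metric Set

/-! ### The projection onto the torus -/

section Torus

variable {N : ℕ}

/-! Write A for the Aubry set. The theorem splits into two independent facts: some critical
subsolution is strict off A, and every such subsolution can be smoothed off A without changing it on
A.

Strictness. If y is not in A, the Mañé column u = Φ_{·,k}(y,·) is a critical subsolution but not a
supersolution. So some component can be raised near some point, by a maximum with a test function,
to give a subsolution that is strict where it was raised. Maximality of u forbids this unless the
raised component is the k-th and y lies in the raised region (`exists_viscStrictAt_of_notMem`).
Raising a strict component a little makes every equation coupled to it strict, so irreducibility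
spreads strictness at y to all components (`exists_viscStrictAt_of_coupled`). Countably many of
these subsolutions cover the complement of A, and an infinite convex combination of them is strict
on all of it (`exists_isStrictIn`).

Smoothing. Average v over balls whose radius r(x) is smooth and positive off A and zero on A. The
gradient of the average is a mean of vectors p - s∇r with p a gradient of v and s bounded, so
convexity of the sublevel sets of H_i and the local slack absorb the error once r and ∇r are small
against that slack (`exists_lhs_mollifyVec_le`). Such a radius is χ∘f with f smooth and zero exactly
on A (`exists_smooth_small`). Since r ≤ f and f has zero gradient on A, the change is o(|y - z|) at
points z of A, and the viscosity inequality survives there (`exists_smooth_approx`). Density follows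
by first mixing in a small multiple of a strict subsolution.

Underneath lie uniform Lipschitz bounds (`exists_bounds`), a one-sided stability principle
(`lhs_le_of_approx`), and the equivalence of viscosity and almost everywhere subsolutions
(`isSubsolution_of_ae`, `ae_of_isSubsolution`), which turns convexity of H_i into convexity of the
set of subsolutions. -/

lemma proj_add (x y : Eucl N) : proj (x + y) = proj x + proj y := by
  funext l; simp [proj]

lemma proj_sub (x y : Eucl N) : proj (x - y) = proj x - proj y := by
  funext l; simp [proj]

lemma continuous_proj : Continuous (proj : Eucl N → Torus N) := by
  refine continuous_pi fun l => ?_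
  exact (AddCircle.continuous_mk' 1).comp (by fun_prop)

lemma dist_proj_le (x y : Eucl N) : dist (proj x) (proj y) ≤ ‖x - y‖ := by
  refine (dist_pi_le_iff (norm_nonneg _)).2 fun l => ?_
  rw [dist_eq_norm]
  have h1 : proj x l - proj y l = (((x - y) l : ℝ) : UnitAddCircle) := by simp [proj]
  rw [h1, UnitAddCircle.norm_eq]
  refine le_trans ?_ (PiLp.norm_apply_le (x - y) l)
  have := round_le ((x - y) l) 0
  simpa using this

/-- Every point of the torus has a lift whose distance to a given point is controlled by the
distance in the torus. -/
lemma exists_lift_near (x : Torus N) (z : Eucl N) :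
    ∃ z', proj z' = x ∧ (∀ l, |z' l - z l| ≤ 1 / 2) ∧ ‖z' - z‖ ≤ N * dist x (proj z) := by
  have h : ∀ l, ∃ t : ℝ, ((t : ℝ) : UnitAddCircle) = x l - proj z l := fun l =>
    QuotientAddGroup.mk_surjective _
  choose t ht using h
  -- Removing the nearest integer makes each coordinate realize the circle norm exactly.
  let d : Eucl N := WithLp.toLp 2 fun l => t l - round (t l)
  have hd : ∀ l, |d l| = ‖x l - proj z l‖ := by
    intro l
    rw [← ht l, UnitAddCircle.norm_eq]
  refine ⟨z + d, ?_, ?_, ?_⟩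
  · funext l
    have h1 : ((round (t l) : ℝ) : UnitAddCircle) = 0 := by
      have := AddCircle.coe_eq_zero_iff (p := (1 : ℝ)) (x := (round (t l) : ℝ))
      exact this.2 ⟨round (t l), by simp⟩
    have h2 : proj (z + d) l = proj z l + (((t l : ℝ) : UnitAddCircle) - ((round (t l) : ℝ) : UnitAddCircle)) := by
      simp [proj, d]
    rw [h2, h1, ht l]; abel
  · intro l
    have : (z + d) l - z l = d l := by simp
    rw [this]
    exact abs_sub_round (t l)
  · have h1 : z + d - z = d := by abel
    rw [h1]
    -- The torus carries the sup metric; passing through the ℓ¹ norm is what costs the factor `N`.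
    have h2 : ‖d‖ ≤ ∑ l, ‖d l‖ := by
      rw [EuclideanSpace.norm_eq]
      refine Real.sqrt_le_iff.2 ⟨Finset.sum_nonneg fun _ _ => norm_nonneg _, ?_⟩
      exact Finset.sum_sq_le_sq_sum_of_nonneg fun _ _ => norm_nonneg _
    refine h2.trans ?_
    calc ∑ l, ‖d l‖ ≤ ∑ _l : Fin N, dist x (proj z) := by
          refine Finset.sum_le_sum fun l _ => ?_
          rw [Real.norm_eq_abs, hd l, ← dist_eq_norm]
          exact dist_le_pi_dist x (proj z) l
      _ = N * dist x (proj z) := by simp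

lemma proj_surjective : Function.Surjective (proj : Eucl N → Torus N) := fun x => by
  obtain ⟨z, hz, -⟩ := exists_lift_near x 0
  exact ⟨z, hz⟩

lemma dist_torus_le (x y : Torus N) : dist x y ≤ 1 := by
  refine (dist_pi_le_iff zero_le_one).2 fun l => ?_
  rw [dist_eq_norm]
  have := AddCircle.norm_le_half_period (1 : ℝ) (x := x l - y l) one_ne_zero
  simp only [abs_one] at this
  linarith

/-- A function on the torus with a Lipschitz lift is Lipschitz. -/
lemma abs_sub_le_of_lift {v : Torus N → ℝ} {L : ℝ} (hL : 0 ≤ L)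
    (h : ∀ z z' : Eucl N, v (proj z) ≤ v (proj z') + L * ‖z - z'‖) (x y : Torus N) :
    |v x - v y| ≤ L * N * dist x y := by
  obtain ⟨z, rfl⟩ := proj_surjective y
  obtain ⟨z', rfl, -, h2⟩ := exists_lift_near x z
  have h3 := h z' z
  have h4 := h z z'
  rw [norm_sub_rev] at h4
  have := mul_le_mul_of_nonneg_left h2 hL
  rw [abs_le]; constructor <;> linarith

end Torus

/-! ### Fréchet superdifferentials -/

section Frechet

variable {N : ℕ}

/-- `p` is a Fréchet supergradient of `f` at `x`. -/
def FrechetSuper (f : Eucl N → ℝ) (x p : Eucl N) : Prop :=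
  ∀ ε > 0, ∀ᶠ z in 𝓝 x, f z ≤ f x + inner ℝ p (z - x) + ε * ‖z - x‖

lemma _root_.HasGradientAt.eventually_abs_le {φ : Eucl N → ℝ} {x p : Eucl N}
    (h : HasGradientAt φ p x) {ε : ℝ} (hε : 0 < ε) :
    ∀ᶠ z in 𝓝 x, |φ z - φ x - inner ℝ p (z - x)| ≤ ε * ‖z - x‖ := by
  have := (hasGradientAt_iff_isLittleO.1 h).bound hε
  filter_upwards [this] with z hz
  simpa using hz

lemma frechetSuper_of_mem_superdifferential {f : Eucl N → ℝ} {x p : Eucl N}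
    (h : p ∈ superdifferential f x) : FrechetSuper f x p := by
  obtain ⟨φ, -, hmax, hg⟩ := h
  intro ε hε
  filter_upwards [hmax, hg.eventually_abs_le hε] with z h1 h2
  have := (abs_le.1 h2).2
  linarith

lemma _root_.HasGradientAt.frechetSuper {f : Eucl N → ℝ} {x p : Eucl N}
    (h : HasGradientAt f p x) : FrechetSuper f x p := by
  intro ε hε
  filter_upwards [h.eventually_abs_le hε] with z h2
  have := (abs_le.1 h2).2
  linarith

/-- Along the direction `q - p` the lower function outgrows the bound imposed by `p` by `t * ‖q - p‖
^ 2`, while the two errors together allow only half of that. This identifies supergradients of a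
maximum where a smooth function touches it from below. -/
lemma FrechetSuper.sub_eq_of_le {f g : Eucl N → ℝ} {x p q : Eucl N} (hf : FrechetSuper f x p)
    (hg : HasGradientAt g q x) (hle : ∀ᶠ z in 𝓝 x, g z ≤ f z) (heq : g x = f x) : p = q := by
  by_contra hne
  have hpos : 0 < ‖q - p‖ := norm_pos_iff.2 (sub_ne_zero.2 (Ne.symm hne))
  have h1 := hf (‖q - p‖ / 4) (by positivity)
  have h2 := hg.eventually_abs_le (ε := ‖q - p‖ / 4) (by positivity)
  obtain ⟨r, hr, hball⟩ := Metric.eventually_nhds_iff.1 (h1.and (h2.and hle))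
  set t : ℝ := r / 2 / ‖q - p‖
  have ht : 0 < t := by positivity
  have hn : ‖t • (q - p)‖ = t * ‖q - p‖ := by rw [norm_smul, Real.norm_of_nonneg ht.le]
  have hd : dist (x + t • (q - p)) x < r := by
    rw [dist_eq_norm, add_sub_cancel_left, hn]
    simp only [t]; field_simp; linarith
  obtain ⟨h3, h4, h5⟩ := hball hd
  rw [add_sub_cancel_left] at h3 h4
  have h6 := (abs_le.1 h4).1
  rw [hn] at h3 h6
  have h7 : inner ℝ q (t • (q - p)) - inner ℝ p (t • (q - p)) = t * ‖q - p‖ ^ 2 := by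
    rw [← inner_sub_left, inner_smul_right, real_inner_self_eq_norm_sq]
  have h8 : 0 < t * ‖q - p‖ ^ 2 := by positivity
  nlinarith

lemma _root_.HasGradientAt.eq_of_frechetSuper {f : Eucl N → ℝ} {x p q : Eucl N}
    (hf : HasGradientAt f q x) (h : FrechetSuper f x p) : p = q :=
  h.sub_eq_of_le hf (.of_forall fun _ => le_rfl) rfl

lemma FrechetSuper.sub_gradient {f g : Eucl N → ℝ} {x p q : Eucl N}
    (hf : FrechetSuper (fun z => f z + g z) x p) (hg : HasGradientAt g q x) :
    FrechetSuper f x (p - q) := by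
  intro ε hε
  filter_upwards [hf (ε / 2) (by positivity), hg.eventually_abs_le (half_pos hε)] with z h1 h2
  have := (abs_le.1 h2).1
  rw [inner_sub_left]
  linarith

lemma FrechetSuper.of_le {f g : Eucl N → ℝ} {x p : Eucl N} (hf : FrechetSuper f x p)
    (hle : ∀ᶠ z in 𝓝 x, g z ≤ f z) (heq : g x = f x) : FrechetSuper g x p := by
  intro ε hε
  filter_upwards [hf ε hε, hle] with z h1 h2
  rw [heq]; exact h2.trans h1

/-- Stepping from `x` in the direction `-p` forces a decrease at rate about `‖p‖`, which the
Lipschitz bound limits to `L`. -/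
lemma FrechetSuper.norm_le {f : Eucl N → ℝ} {x p : Eucl N} (h : FrechetSuper f x p) {L : ℝ}
    (hL0 : 0 ≤ L) (hL : ∀ z z', f z ≤ f z' + L * ‖z - z'‖) : ‖p‖ ≤ L := by
  refine le_of_forall_pos_le_add fun ε hε => ?_
  by_contra! hlt
  obtain ⟨r, hr, hball⟩ := Metric.eventually_nhds_iff.1 (h ε hε)
  by_cases hp : p = 0
  · simp only [hp, norm_zero] at hlt
    linarith
  have hpos : 0 < ‖p‖ := norm_pos_iff.2 hp
  set t : ℝ := r / 2 / ‖p‖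
  have ht : 0 < t := by positivity
  have hn : ‖t • p‖ = t * ‖p‖ := by rw [norm_smul, Real.norm_of_nonneg ht.le]
  have hd : dist (x - t • p) x < r := by
    rw [dist_eq_norm, sub_sub_cancel_left, norm_neg, hn]
    simp only [t]; field_simp; linarith
  have h3 := hball hd
  have h4 := hL x (x - t • p)
  rw [sub_sub_cancel_left] at h3
  rw [sub_sub_cancel, hn] at h4
  rw [norm_neg, hn, inner_neg_right, inner_smul_right, real_inner_self_eq_norm_sq] at h3
  have : t * ‖p‖ * ‖p‖ ≤ t * ‖p‖ * (L + ε) := by nlinarith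
  have h9 : 0 < t * ‖p‖ := by positivity
  have := le_of_mul_le_mul_left this h9
  linarith

/-- A continuous function that lies below an affine function up to a small error, with almost
equality at the centre, has a supergradient close to the slope at a nearby point. -/
lemma exists_superdifferential_near {g : Eucl N → ℝ} {x p : Eucl N} {r e c : ℝ} (hr : 0 < r)
    (he : 0 < e) (hg : ContinuousOn g (closedBall x r))
    (hle : ∀ z ∈ sphere x r, g z ≤ c + inner ℝ p (z - x) + e * r) (hx : c - e * r ≤ g x) :
    ∃ z ∈ ball x r, ∃ q ∈ superdifferential g z, ‖q - p‖ ≤ 6 * e ∧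
      c - e * r + inner ℝ p (z - x) ≤ g z := by
  -- On the sphere the quadratic term equals `3 * e * r`, more than the error `e * r` there plus the
  -- deficit `e * r` at the centre, so the maximum is interior. Its gradient in the ball is at most
  -- `6 * e`.
  set φ : Eucl N → ℝ := fun z => inner ℝ p (z - x) + 3 * e / r * ‖z - x‖ ^ 2 with hφ
  have hφc : Continuous φ := by fun_prop
  obtain ⟨z, hz, hmax⟩ := (isCompact_closedBall x r).exists_isMaxOn (f := fun z => g z - φ z)
    ⟨x, mem_closedBall_self hr.le⟩ (hg.sub hφc.continuousOn)
  have hφx : φ x = 0 := by simp [hφ]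
  have hzx : g x ≤ g z - φ z := by
    have : g x - φ x ≤ g z - φ z := hmax (mem_closedBall_self hr.le)
    linarith
  have hzb : z ∈ ball x r := by
    rcases (mem_closedBall.1 hz).lt_or_eq with h | h
    · exact h
    · exfalso
      have h1 := hle z h
      have h2 : ‖z - x‖ = r := by rwa [← dist_eq_norm]
      have h3 : φ z = inner ℝ p (z - x) + 3 * (e * r) := by
        simp only [hφ, h2]; field_simp
      have : 0 < e * r := by positivity
      linarith
  have hgrad : HasGradientAt φ (p + (6 * e / r) • (z - x)) z := by
    rw [hasGradientAt_iff_hasFDerivAt]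
    have h1 : HasFDerivAt (fun z : Eucl N => z - x) (ContinuousLinearMap.id ℝ (Eucl N)) z :=
      (hasFDerivAt_id z).sub_const x
    have h2 : HasFDerivAt (fun z : Eucl N => inner ℝ p (z - x)) 
        ((innerSL ℝ p).comp (ContinuousLinearMap.id ℝ (Eucl N))) z :=
      (innerSL ℝ p).hasFDerivAt.comp z h1
    have h3 := (h1.norm_sq).const_mul (3 * e / r)
    refine (h2.add h3).congr_fderiv ?_
    ext y
    simp only [map_add, map_smul, InnerProductSpace.toDual_apply_apply, add_apply,
      smul_apply, innerSL_apply_apply, ContinuousLinearMap.comp_apply,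
      ContinuousLinearMap.id_apply, smul_eq_mul, nsmul_eq_mul]
    push_cast
    ring
  refine ⟨z, hzb, _, ⟨φ, ?_, ?_, hgrad⟩, ?_, ?_⟩
  · have : ContDiff ℝ 1 φ := by
      have h1 : ContDiff ℝ 1 fun z : Eucl N => z - x := contDiff_id.sub contDiff_const
      exact (contDiff_const.inner ℝ h1).add (contDiff_const.mul (h1.norm_sq ℝ))
    exact this.contDiffAt
  · filter_upwards [isOpen_ball.mem_nhds hzb] with y hy
    exact hmax (ball_subset_closedBall hy)
  · rw [add_sub_cancel_left, norm_smul, Real.norm_of_nonneg (by positivity)]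
    have : ‖z - x‖ ≤ r := by rw [← dist_eq_norm]; exact hz
    calc 6 * e / r * ‖z - x‖ ≤ 6 * e / r * r := by gcongr
      _ = 6 * e := by field_simp
  · have : 0 ≤ 3 * e / r * ‖z - x‖ ^ 2 := by positivity
    simp only [hφ] at hzx
    linarith

end Frechet

end WeaklyCoupled

namespace WeaklyCoupled

open Filter Metric Set

/-! ### Coupling matrices -/

section Matrix

variable {m : ℕ}

lemma mulVec_add_const {M : Matrix (Fin m) (Fin m) ℝ} (hd : IsDegenerate M) (u : Fin m → ℝ)
    (c : ℝ) (i : Fin m) : M.mulVec (fun j => u j + c) i = M.mulVec u i := by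
  simp only [Matrix.mulVec, dotProduct, mul_add, Finset.sum_add_distrib]
  rw [← Finset.sum_mul, hd i, zero_mul, add_zero]

lemma IsCoupling.diag_nonneg {M : Matrix (Fin m) (Fin m) ℝ} (hM : IsCoupling M) (i : Fin m) :
    0 ≤ M i i := by
  have h1 := hM.2 i
  rw [← Finset.add_sum_erase _ _ (Finset.mem_univ i)] at h1
  have h2 : ∑ j ∈ Finset.univ.erase i, M i j ≤ 0 :=
    Finset.sum_nonpos fun j hj => hM.1 i j (Finset.ne_of_mem_erase hj)
  linarith

/-- Monotonicity of `M u` in the components other than `i`. -/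
lemma IsCoupling.mulVec_le {M : Matrix (Fin m) (Fin m) ℝ} (hM : IsCoupling M)
    {u w : Fin m → ℝ} (i : Fin m) (h : ∀ j, j ≠ i → w j ≤ u j) :
    M.mulVec u i ≤ M.mulVec w i + M i i * (u i - w i) := by
  have h1 : M.mulVec w i - M.mulVec u i = ∑ j, M i j * (w j - u j) := by
    simp only [Matrix.mulVec, dotProduct, mul_sub, Finset.sum_sub_distrib]
  have h2 : M i i * (w i - u i) ≤ ∑ j, M i j * (w j - u j) := by
    rw [← Finset.add_sum_erase _ _ (Finset.mem_univ i)]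
    refine le_add_of_nonneg_right (Finset.sum_nonneg fun j hj => ?_)
    have hj := Finset.ne_of_mem_erase hj
    exact mul_nonneg_of_nonpos_of_nonpos (hM.1 i j hj) (by linarith [h j hj])
  linarith

end Matrix

/-- The standing assumptions on the Hamiltonians and on the coupling matrix. -/
structure Admissible {N m : ℕ} (H : Fin m → Torus N → Eucl N → ℝ)
    (B : Torus N → Matrix (Fin m) (Fin m) ℝ) : Prop where
  ham : ∀ i, IsConvexHamiltonian (H i)
  cont : Continuous B
  coupling : ∀ x, IsCoupling (B x)
  irred : ∀ x, IsIrreducible (B x)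
  deg : ∀ x, IsDegenerate (B x)

/-! ### Stability of viscosity subsolutions under one-sided approximation -/

section System

variable {N m : ℕ} {H : Fin m → Torus N → Eucl N → ℝ}
  {B : Torus N → Matrix (Fin m) (Fin m) ℝ}

lemma continuous_liftComp {u : Torus N → Fin m → ℝ} (hu : Continuous u) (i : Fin m) :
    Continuous (liftComp u i) :=
  (continuous_apply i).comp (hu.comp continuous_proj)

lemma Admissible.continuous_ham (S : Admissible H B) (i : Fin m) :
    Continuous fun z : Torus N × Eucl N => H i z.1 z.2 := (S.ham i).continuous

lemma Admissible.continuous_mulVec (S : Admissible H B) {u : Torus N → Fin m → ℝ}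
    (hu : Continuous u) (i : Fin m) : Continuous fun x => (B x).mulVec (u x) i := by
  have : Continuous fun x => (B x).mulVec (u x) := S.cont.matrix_mulVec hu
  exact (continuous_apply i).comp this

lemma Admissible.continuous_entry (S : Admissible H B) (i j : Fin m) :
    Continuous fun x => B x i j := S.cont.matrix_elem i j

/-- Stability of the subsolution inequality under approximation from below. -/
lemma Admissible.lhs_le_of_approx (S : Admissible H B) {u : Torus N → Fin m → ℝ}
    (hu : Continuous u) {a : ℝ} {i : Fin m} {x p : Eucl N}
    (hp : FrechetSuper (liftComp u i) x p)
    (h : ∀ η > 0, ∃ v, IsSubsolution H B (fun _ => a + η) v ∧ (∀ y j, v y j ≤ u y j + η) ∧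
      u (proj x) i - η ≤ v (proj x) i) :
    lhs H B u i (proj x) p ≤ a := by
  -- At a point `z` where a test function of slope `q` touches `v`, replace `v` by `u` in the
  -- coupling term. Off-diagonal entries are nonpositive, so `v ≤ u + η` suffices for them; the
  -- diagonal entry needs a lower bound on `v i` at `z`, which the touching lemma provides. No lower
  -- bound on the other components is needed.
  have key : ∀ n : ℕ, ∃ (z q : Eucl N) (r η : ℝ), ‖z - x‖ ≤ 1 / ((n : ℝ) + 1) ∧
      ‖q - p‖ ≤ 6 * (1 / ((n : ℝ) + 1)) ∧ 0 ≤ r ∧ r ≤ 1 / ((n : ℝ) + 1) ∧ 0 ≤ η ∧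
      η ≤ 1 / ((n : ℝ) + 1) ∧
      H i (proj z) q + (B (proj z)).mulVec (u (proj z)) i - B (proj z) i i *
        (u (proj z) i + η - (u (proj x) i - r + inner ℝ p (z - x))) ≤ a + η := by
    intro n
    set e : ℝ := 1 / ((n : ℝ) + 1) with he
    have hepos : 0 < e := by positivity
    have he1 : e ≤ 1 := by
      rw [he, div_le_one (by positivity)]; linarith [(Nat.cast_nonneg n : (0 : ℝ) ≤ n)]
    obtain ⟨r0, hr0, hball⟩ := Metric.eventually_nhds_iff.1 (hp (e / 2) (by positivity))
    set r : ℝ := min (r0 / 2) e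
    have hr : 0 < r := by positivity
    have hre : r ≤ e := min_le_right _ _
    have her : 0 < e * r := by positivity
    have her1 : e * r ≤ e := by nlinarith
    -- An approximation finer than the radius by the factor `e` perturbs slopes only by a multiple
    -- of `e`.
    obtain ⟨v, hv, hvle, hvx⟩ := h (e * r / 2) (by positivity)
    obtain ⟨z, hz, q, hq, hqp, hgz⟩ := exists_superdifferential_near (g := liftComp v i)
      (x := x) (p := p) (r := r) (e := e) (c := u (proj x) i) hr hepos
      (continuous_liftComp hv.1 i).continuousOn (fun z hz => by
        have hzx : ‖z - x‖ = r := by rwa [← dist_eq_norm]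
        have h1 := @hball z (by
          rw [dist_eq_norm, hzx]
          exact (min_le_left _ _).trans_lt (by linarith))
        have h2 := hvle (proj z) i
        simp only [liftComp, hzx] at h1 ⊢
        linarith) (by simp only [liftComp]; linarith)
    refine ⟨z, q, e * r, e * r / 2, ?_, hqp, her.le, her1, by positivity, by linarith, ?_⟩
    · rw [← dist_eq_norm]; exact (mem_ball.1 hz).le.trans hre
    · have h1 := hv.2 i z q hq
      have h2 := (S.coupling (proj z)).mulVec_le (u := fun j => u (proj z) j + e * r / 2)
        (w := v (proj z)) i fun j _ => hvle _ _
      rw [mulVec_add_const (S.deg _)] at h2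
      have h3 := mul_le_mul_of_nonneg_left (a := B (proj z) i i) (sub_le_sub_left hgz
        (u (proj z) i + e * r / 2)) ((S.coupling (proj z)).diag_nonneg i)
      simp only [lhs, liftComp] at h1 h2 h3
      linarith
  choose z q r η hz hq hr0 hr hη0 hη hmain using key
  have h0 : Tendsto (fun n : ℕ => 1 / ((n : ℝ) + 1)) atTop (𝓝 0) :=
    tendsto_one_div_add_atTop_nhds_zero_nat
  have tz : Tendsto z atTop (𝓝 x) := by
    rw [tendsto_iff_norm_sub_tendsto_zero]
    exact squeeze_zero (fun _ => norm_nonneg _) hz h0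
  have tq : Tendsto q atTop (𝓝 p) := by
    rw [tendsto_iff_norm_sub_tendsto_zero]
    exact squeeze_zero (fun _ => norm_nonneg _) hq (by simpa using h0.const_mul 6)
  have tr : Tendsto r atTop (𝓝 0) := squeeze_zero hr0 hr h0
  have tη : Tendsto η atTop (𝓝 0) := squeeze_zero hη0 hη h0
  have tpz : Tendsto (fun n => proj (z n)) atTop (𝓝 (proj x)) :=
    (continuous_proj.tendsto x).comp tz
  have t1 : Tendsto (fun n => H i (proj (z n)) (q n)) atTop (𝓝 (H i (proj x) p)) :=
    ((S.continuous_ham i).tendsto (proj x, p)).comp (tpz.prodMk_nhds tq)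
  have t2 := ((S.continuous_mulVec hu i).tendsto (proj x)).comp tpz
  have t3 := ((S.continuous_entry i i).tendsto (proj x)).comp tpz
  have t4 := ((continuous_liftComp hu i).tendsto x).comp tz
  have t5 : Tendsto (fun n => inner ℝ p (z n - x)) atTop (𝓝 (inner ℝ p (x - x))) :=
    (tendsto_const_nhds).inner (tz.sub_const x)
  have t6 := (t1.add t2).sub (t3.mul ((t4.add tη).sub ((tr.const_sub (u (proj x) i)).add t5)))
  have t7 := tη.const_add a
  have := le_of_tendsto_of_tendsto' t6 t7 hmain
  simp only [sub_self, inner_zero_right, liftComp, add_zero, sub_zero, mul_zero] at this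
  exact this

/-- Fréchet supergradients come without a `C^1` test function, so a limit of nearby genuine
superdifferentials is needed: this is the stability lemma with `u` as its own approximation. From
here on the Fréchet form is the working definition. -/
lemma Admissible.isSubsolution_iff (S : Admissible H B) {u : Torus N → Fin m → ℝ} {a : ℝ} :
    IsSubsolution H B (fun _ => a) u ↔ Continuous u ∧ ∀ i x p,
      FrechetSuper (liftComp u i) x p → lhs H B u i (proj x) p ≤ a := by
  refine ⟨fun h => ⟨h.1, fun i x p hp => ?_⟩, fun h => ⟨h.1, fun i x p hp =>
    h.2 i x p (frechetSuper_of_mem_superdifferential hp)⟩⟩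
  refine S.lhs_le_of_approx h.1 hp fun η hη => ⟨u, ⟨h.1, fun j y q hq => ?_⟩, ?_, ?_⟩
  · linarith [h.2 j y q hq]
  · intro y j; linarith
  · linarith

/-- Stability of subsolutions under approximation from below. -/
lemma Admissible.isSubsolution_of_approx (S : Admissible H B) {u : Torus N → Fin m → ℝ}
    (hu : Continuous u) {a : ℝ}
    (h : ∀ x i, ∀ η > 0, ∃ v, IsSubsolution H B (fun _ => a + η) v ∧
      (∀ y j, v y j ≤ u y j + η) ∧ u x i - η ≤ v x i) :
    IsSubsolution H B (fun _ => a) u :=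
  S.isSubsolution_iff.2 ⟨hu, fun i x _ hp => S.lhs_le_of_approx hu hp (h (proj x) i)⟩

lemma IsSubsolution.mono {a b : ℝ} {u : Torus N → Fin m → ℝ}
    (h : IsSubsolution H B (fun _ => a) u) (hab : a ≤ b) : IsSubsolution H B (fun _ => b) u :=
  ⟨h.1, fun i x p hp => (h.2 i x p hp).trans hab⟩

lemma Admissible.isSubsolution_add_const (S : Admissible H B) {u : Torus N → Fin m → ℝ} {a : ℝ}
    (h : IsSubsolution H B (fun _ => a) u) (c : ℝ) :
    IsSubsolution H B (fun _ => a) fun x j => u x j + c := by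
  rw [S.isSubsolution_iff] at h ⊢
  refine ⟨continuous_pi fun j => ((continuous_apply j).comp h.1).add_const c, fun i x p hp => ?_⟩
  have h1 : FrechetSuper (liftComp u i) x p := by
    intro ε hε
    filter_upwards [hp ε hε] with z hz
    simp only [liftComp] at hz ⊢
    linarith
  have := h.2 i x p h1
  simpa [lhs, mulVec_add_const (S.deg _)] using this

/-! ### A priori estimates -/

lemma Admissible.exists_ham_lower_bound (S : Admissible H B) : ∃ C : ℝ, ∀ i x p, -C ≤ H i x p := by
  have : ∀ i, ∃ C : ℝ, ∀ x p, -C ≤ H i x p := by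
    intro i
    obtain ⟨α, β, hα, -, hαβ⟩ := (S.ham i).coercive
    obtain ⟨R, hR⟩ := (hα.eventually (eventually_ge_atTop 0)).exists_forall_of_atTop
    obtain ⟨C, hC⟩ := ((isCompact_univ (X := Torus N)).prod
      (isCompact_closedBall (0 : Eucl N) R)).exists_bound_of_continuousOn
      (S.continuous_ham i).continuousOn
    refine ⟨max C 0, fun x p => ?_⟩
    by_cases hp : ‖p‖ ≤ R
    · have := hC (x, p) ⟨mem_univ _, by simpa using hp⟩
      have := (abs_le.1 (this : |H i x p| ≤ C)).1
      linarith [le_max_left C 0]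
    · have h1 := hR ‖p‖₊ (by rw [← NNReal.coe_le_coe]; exact (not_le.1 hp).le)
      have h2 := (hαβ x p).1
      linarith [le_max_right C 0]
  choose C hC using this
  refine ⟨∑ i, |C i|, fun i x p => ?_⟩
  have h1 := hC i x p
  have h2 : |C i| ≤ ∑ i, |C i| :=
    Finset.single_le_sum (f := fun i => |C i|) (fun _ _ => abs_nonneg _) (Finset.mem_univ i)
  linarith [le_abs_self (C i)]

lemma Admissible.exists_norm_le_of_ham_le (S : Admissible H B) (C : ℝ) :
    ∃ R : ℝ, 0 ≤ R ∧ ∀ i x p, H i x p ≤ C → ‖p‖ ≤ R := by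
  have : ∀ i, ∃ R : ℝ, 0 ≤ R ∧ ∀ x p, H i x p ≤ C → ‖p‖ ≤ R := by
    intro i
    obtain ⟨α, β, hα, -, hαβ⟩ := (S.ham i).coercive
    obtain ⟨R, hR⟩ := (hα.eventually (eventually_gt_atTop C)).exists_forall_of_atTop
    refine ⟨R, R.2, fun x p hp => ?_⟩
    by_contra! hlt
    have h1 := hR ‖p‖₊ (by rw [← NNReal.coe_le_coe]; exact hlt.le)
    have h2 := (hαβ x p).1
    linarith
  choose R hR0 hR using this
  refine ⟨∑ i, R i, Finset.sum_nonneg fun i _ => hR0 i, fun i x p hp => (hR i x p hp).trans ?_⟩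
  exact Finset.single_le_sum (f := R) (fun i _ => hR0 i) (Finset.mem_univ i)

/-- The oscillation of a vector is controlled by the positive part of its image under an
irreducible degenerate coupling matrix. -/
lemma IsCoupling.exists_mulVec_pos {M : Matrix (Fin m) (Fin m) ℝ} (hM : IsCoupling M)
    (hd : IsDegenerate M) (hirr : IsIrreducible M) {u : Fin m → ℝ} {i j : Fin m}
    (hij : u j < u i) : ∃ l, 0 < M.mulVec u l := by
  have : Nonempty (Fin m) := ⟨i⟩
  obtain ⟨l0, hl0⟩ := Finite.exists_max u
  -- Irreducibility is applied to the set of maximizers: in the row of a maximizer `l` coupled to a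
  -- non-maximizer `l'`, zero row sum makes every term `M l s * (u s - u l)` nonnegative and the one
  -- at `l'` positive.
  obtain ⟨l, hl, l', hl', hne⟩ := hirr {l | u l = u l0} ⟨l0, rfl⟩ (by
    intro h
    have h1 : u i = u l0 := (Set.ext_iff.1 h i).2 trivial
    have h2 : u j = u l0 := (Set.ext_iff.1 h j).2 trivial
    linarith)
  have hl : u l = u l0 := hl
  have hl' : u l' ≠ u l0 := hl'
  have hlt : u l' < u l := hl ▸ lt_of_le_of_ne (hl0 l') hl'
  have hll : l' ≠ l := by rintro rfl; exact hl' hl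
  refine ⟨l, ?_⟩
  have h1 : M.mulVec u l = ∑ s, M l s * (u s - u l) := by
    simp only [Matrix.mulVec, dotProduct, mul_sub, Finset.sum_sub_distrib]
    rw [← Finset.sum_mul, hd l, zero_mul, sub_zero]
  rw [h1]
  refine Finset.sum_pos' (fun s _ => ?_) ⟨l', Finset.mem_univ _, ?_⟩
  · by_cases hs : s = l
    · simp [hs]
    · exact mul_nonneg_of_nonpos_of_nonpos (hM.1 l s hs) (by rw [hl]; linarith [hl0 s])
  · exact mul_pos_of_neg_of_neg (lt_of_le_of_ne (hM.1 l l' hll) hne) (by linarith)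

/-- By compactness, the largest entry of `B x u` is bounded below by a positive constant over all
`x` and all `u` with values in `[0, 1]` attaining 0 and 1. Zero row sums and homogeneity carry this
to every `u` by affine rescaling. -/
lemma Admissible.exists_oscillation_bound (S : Admissible H B) : ∃ κ : ℝ, 0 < κ ∧
    ∀ (x : Torus N) (u : Fin m → ℝ) (i j : Fin m), ∃ l, κ * (u i - u j) ≤ (B x).mulVec u l := by
  rcases isEmpty_or_nonempty (Fin m) with hm | hm
  · exact ⟨1, one_pos, fun _ _ i => isEmptyElim i⟩
  set F : Torus N × (Fin m → ℝ) → ℝ := fun z =>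
    Finset.univ.sup' Finset.univ_nonempty fun l => (B z.1).mulVec z.2 l with hF
  have hFc : Continuous F := by
    refine Continuous.finset_sup'_apply _ fun l _ => ?_
    exact (continuous_apply l).comp ((S.cont.comp continuous_fst).matrix_mulVec continuous_snd)
  have key : ∀ i j : Fin m, ∃ κ : ℝ, 0 < κ ∧ ∀ (x : Torus N) (u : Fin m → ℝ),
      (∀ l, u l ∈ Icc (0 : ℝ) 1) → u i = 1 → u j = 0 → κ ≤ F (x, u) := by
    intro i j
    set K : Set (Torus N × (Fin m → ℝ)) :=
      univ ×ˢ ((Set.pi univ fun _ => Icc (0 : ℝ) 1) ∩ {u | u i = 1} ∩ {u | u j = 0}) with hK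
    have hKc : IsCompact K := by
      refine isCompact_univ.prod (((isCompact_univ_pi fun _ => isCompact_Icc).inter_right ?_).inter_right ?_)
      · exact isClosed_eq (continuous_apply i) continuous_const
      · exact isClosed_eq (continuous_apply j) continuous_const
    rcases K.eq_empty_or_nonempty with hemp | hne
    · refine ⟨1, one_pos, fun x u h0 h1 h2 => ?_⟩
      exact absurd (show (x, u) ∈ K from ⟨mem_univ _, ⟨fun l _ => h0 l, h1⟩, h2⟩) (by simp [hemp])
    · obtain ⟨⟨x0, u0⟩, hz, hmin⟩ := hKc.exists_isMinOn hne hFc.continuousOn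
      refine ⟨F (x0, u0), ?_, fun x u h0 h1 h2 =>
        hmin (show (x, u) ∈ K from ⟨mem_univ _, ⟨fun l _ => h0 l, h1⟩, h2⟩)⟩
      have e1 : u0 i = 1 := hz.2.1.2
      have e2 : u0 j = 0 := hz.2.2
      obtain ⟨l, hl⟩ := (S.coupling x0).exists_mulVec_pos (S.deg x0) (S.irred x0)
        (u := u0) (i := i) (j := j) (by rw [e1, e2]; exact one_pos)
      exact hl.trans_le (Finset.le_sup' (fun l => (B x0).mulVec u0 l) (Finset.mem_univ l))
  choose κ hκ0 hκ using key
  obtain ⟨⟨i1, j1⟩, hmin⟩ := Finite.exists_min fun z : Fin m × Fin m => κ z.1 z.2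
  refine ⟨κ i1 j1, hκ0 _ _, fun x u i j => ?_⟩
  obtain ⟨i0, hi0⟩ := Finite.exists_max u
  obtain ⟨j0, hj0⟩ := Finite.exists_min u
  rcases (hj0 i0).eq_or_lt with heq | hlt
  · have hconst : ∀ l, u l = u j0 := fun l => le_antisymm ((hi0 l).trans heq.symm.le) (hj0 l)
    refine ⟨i, ?_⟩
    have : u = fun l => (0 : Fin m → ℝ) l + u j0 := by funext l; simp [hconst l]
    rw [hconst i, hconst j, this, mulVec_add_const (S.deg x)]
    simp
  · set s := u i0 - u j0 with hs
    have hs0 : 0 < s := by linarith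
    have h1 := hκ i0 j0 x (fun l => (u l - u j0) / s)
      (fun l => ⟨div_nonneg (by linarith [hj0 l]) hs0.le, (div_le_one hs0).2 (by linarith [hi0 l])⟩)
      (div_self hs0.ne') (by simp)
    obtain ⟨l, -, hl⟩ := Finset.exists_mem_eq_sup' Finset.univ_nonempty
      (fun l => (B x).mulVec (fun l => (u l - u j0) / s) l)
    rw [hF] at h1
    simp only at h1
    rw [hl] at h1
    refine ⟨l, ?_⟩
    have h2 : (B x).mulVec u l = s * (B x).mulVec (fun l => (u l - u j0) / s) l := by
      have e1 : (fun l => (u l - u j0) / s) = s⁻¹ • fun l => u l + (-u j0) := by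
        funext l; simp [div_eq_inv_mul, sub_eq_add_neg]
      rw [e1, Matrix.mulVec_smul, Pi.smul_apply, mulVec_add_const (S.deg x), smul_eq_mul,
        mul_inv_cancel_left₀ hs0.ne']
    rw [h2]
    have h3 := hmin (i0, j0)
    simp only at h3
    have h4 : u i - u j ≤ s := by linarith [hi0 i, hj0 j]
    calc κ i1 j1 * (u i - u j) ≤ κ i1 j1 * s := mul_le_mul_of_nonneg_left h4 (hκ0 _ _).le
      _ ≤ κ i0 j0 * s := mul_le_mul_of_nonneg_right h3 hs0.le
      _ ≤ _ := by rw [mul_comm]; exact mul_le_mul_of_nonneg_left h1 hs0.le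

/-- Points with nonempty superdifferential are dense. -/
lemma exists_superdifferential_mem_ball {g : Eucl N → ℝ} (hg : Continuous g) (x : Eucl N) {r : ℝ}
    (hr : 0 < r) : ∃ z ∈ ball x r, (superdifferential g z).Nonempty := by
  obtain ⟨C, hC⟩ := (isCompact_closedBall x r).exists_bound_of_continuousOn hg.continuousOn
  have hC0 : 0 ≤ C := (norm_nonneg _).trans (hC x (mem_closedBall_self hr.le))
  -- This `e` makes `e * r = 2 * C + 1` exceed the oscillation of `g` on the ball, so the slope 0 is
  -- admissible.
  obtain ⟨z, hz, q, hq, -⟩ := exists_superdifferential_near (g := g) (x := x) (p := 0) (r := r)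
    (e := (2 * C + 1) / r) (c := g x) hr (by positivity) hg.continuousOn (fun z hz => by
      have h1 := (abs_le.1 (hC z (sphere_subset_closedBall hz))).2
      have h2 := (abs_le.1 (hC x (mem_closedBall_self hr.le))).1
      rw [div_mul_cancel₀ _ hr.ne', inner_zero_left]
      linarith) (by rw [div_mul_cancel₀ _ hr.ne']; linarith)
  exact ⟨z, hz, q, hq⟩

/-- Uniform oscillation and Lipschitz bounds for subsolutions. -/
lemma Admissible.exists_bounds (S : Admissible H B) : ∃ C L : ℝ, 0 ≤ C ∧ 0 ≤ L ∧
    ∀ u, IsSubsolution H B (fun _ => 1) u →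
      (∀ x i j, u x i - u x j ≤ C) ∧
      ∀ i (z z' : Eucl N), u (proj z) i ≤ u (proj z') i + L * ‖z - z'‖ := by
  obtain ⟨C0, hC0⟩ := S.exists_ham_lower_bound
  obtain ⟨κ, hκ0, hκ⟩ := S.exists_oscillation_bound
  set C1 : ℝ := |1 + C0|
  -- `H` is bounded below, so the coupling term is bounded above wherever the superdifferential is
  -- nonempty, hence everywhere by density; the oscillation bound then applies.
  have hosc : ∀ u, IsSubsolution H B (fun _ => 1) u → ∀ x i j, u x i - u x j ≤ C1 / κ := by
    intro u hu x i j
    have hB : ∀ l (y : Eucl N), (B (proj y)).mulVec (u (proj y)) l ≤ C1 := by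
      intro l y
      have hcont : Continuous fun y : Eucl N => (B (proj y)).mulVec (u (proj y)) l :=
        (S.continuous_mulVec hu.1 l).comp continuous_proj
      have hcl : IsClosed {y : Eucl N | (B (proj y)).mulVec (u (proj y)) l ≤ C1} :=
        isClosed_le hcont continuous_const
      refine hcl.closure_subset (Metric.mem_closure_iff.2 fun r hr => ?_)
      obtain ⟨z, hz, q, hq⟩ := exists_superdifferential_mem_ball (continuous_liftComp hu.1 l) y hr
      refine ⟨z, ?_, by rwa [dist_comm]⟩
      have h1 := hu.2 l z q hq
      have h2 := hC0 l (proj z) q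
      simp only [lhs] at h1
      have := le_abs_self (1 + C0)
      change (B (proj z)).mulVec (u (proj z)) l ≤ C1
      linarith
    obtain ⟨y, rfl⟩ := proj_surjective x
    obtain ⟨l, hl⟩ := hκ (proj y) (u (proj y)) i j
    rw [le_div_iff₀ hκ0, mul_comm]
    exact hl.trans (hB l y)
  have hdiag : ∃ D : ℝ, ∀ (x : Torus N) i, B x i i ≤ D := by
    have : ∀ i, ∃ D, 0 ≤ D ∧ ∀ x, B x i i ≤ D := by
      intro i
      obtain ⟨D, hD⟩ := (isCompact_univ (X := Torus N)).exists_bound_of_continuousOn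
        (S.continuous_entry i i).continuousOn
      exact ⟨|D|, abs_nonneg _, fun x =>
        (le_abs_self _).trans ((hD x (mem_univ _)).trans (le_abs_self _))⟩
    choose D hD0 hD using this
    exact ⟨∑ i, D i, fun x i => (hD i x).trans
      (Finset.single_le_sum (fun i _ => hD0 i) (Finset.mem_univ i))⟩
  obtain ⟨D, hD⟩ := hdiag
  -- Comparing `u` with the constant vector `u i + C1 / κ` bounds the coupling term below by `-D *
  -- (C1 / κ)`, which leaves this upper bound for `H`.
  obtain ⟨R, hR0, hR⟩ := S.exists_norm_le_of_ham_le (1 + D * (C1 / κ))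
  have hC1 : 0 ≤ C1 / κ := by positivity
  refine ⟨C1 / κ, R + 1, hC1, by linarith, fun u hu => ⟨hosc u hu, fun i z0' z0 => ?_⟩⟩
  have hsup : ∀ x p, p ∈ superdifferential (liftComp u i) x → ‖p‖ ≤ R := by
    intro x p hp
    refine hR i (proj x) p ?_
    have h1 := hu.2 i x p hp
    have h2 := (S.coupling (proj x)).mulVec_le (u := fun j => (0 : Fin m → ℝ) j + (u (proj x) i + C1 / κ))
      (w := u (proj x)) i (fun j _ => by simp; linarith [hosc u hu (proj x) j i])
    rw [mulVec_add_const (S.deg _)] at h2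
    simp only [Matrix.mulVec_zero, Pi.zero_apply, zero_add, add_sub_cancel_left] at h2
    have h3 := mul_le_mul_of_nonneg_right (hD (proj x) i) hC1
    simp only [lhs] at h1
    linarith
  have hc := continuous_liftComp hu.1 i
  obtain ⟨M, hM⟩ := (isCompact_univ (X := Torus N)).exists_bound_of_continuousOn
    ((continuous_apply i).comp hu.1).continuousOn
  have hM : ∀ z : Eucl N, |liftComp u i z| ≤ M := fun z => hM (proj z) (mem_univ _)
  have hM0 : 0 ≤ M := (abs_nonneg _).trans (hM 0)
  -- Cone comparison: away from the vertex the cone is smooth with slope `R + 1`, too steep for a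
  -- supergradient of `u i`, so the maximum of `u i - φ` sits at the vertex.
  set φ : Eucl N → ℝ := fun z => (R + 1) * ‖z - z0‖ with hφ
  have hφc : Continuous φ := by fun_prop
  -- With slope at least 1, the cone exceeds the oscillation `2 * M` on the boundary of this ball,
  -- so the maximum is interior.
  set r := 2 * M + 1
  have hr : 0 < r := by positivity
  obtain ⟨z, hz, hmax⟩ := (isCompact_closedBall z0 r).exists_isMaxOn
    (f := fun z => liftComp u i z - φ z)
    ⟨z0, mem_closedBall_self hr.le⟩ (hc.sub hφc).continuousOn
  have h0 : liftComp u i z0 ≤ liftComp u i z - φ z := by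
    have : liftComp u i z0 - φ z0 ≤ liftComp u i z - φ z := hmax (mem_closedBall_self hr.le)
    simpa [hφ] using this
  have hzb : z ∈ ball z0 r := by
    rw [mem_ball, dist_eq_norm]
    have h1 := (abs_le.1 (hM z0)).1
    have h2 := (abs_le.1 (hM z)).2
    simp only [hφ] at h0
    nlinarith [norm_nonneg (z - z0)]
  have hzz : z = z0 := by
    by_contra hne
    have hne' : z - z0 ≠ 0 := sub_ne_zero.2 hne
    have hd : HasFDerivAt (fun z : Eucl N => z - z0) (ContinuousLinearMap.id ℝ (Eucl N)) z :=
      (hasFDerivAt_id z).sub_const z0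
    have hn : ContDiffAt ℝ 1 φ z := by
      have h1 : ContDiffAt ℝ 1 (fun z : Eucl N => z - z0) z := contDiffAt_id.sub contDiffAt_const
      exact contDiffAt_const.mul (h1.norm ℝ hne')
    have hdiff : DifferentiableAt ℝ φ z := hn.differentiableAt one_ne_zero
    have hg := hdiff.hasGradientAt
    have h2 := hsup z _ ⟨φ, hn, by
      filter_upwards [isOpen_ball.mem_nhds hzb] with y hy
      exact hmax (ball_subset_closedBall hy), hg⟩
    -- Towards the vertex the cone drops at rate `R + 1`, whereas a gradient of norm at most `R`
    -- with error `1 / 2` allows at most `R + 1 / 2`.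
    have h3 := hg.eventually_abs_le (ε := 1 / 2) (by norm_num)
    obtain ⟨ρ, hρ, hball⟩ := Metric.eventually_nhds_iff.1 h3
    set n := ‖z - z0‖
    have hn0 : 0 < n := norm_pos_iff.2 hne'
    set t : ℝ := min (ρ / 2 / n) 1
    have ht : 0 < t := by positivity
    have htn : ‖-t • (z - z0)‖ = t * n := by rw [norm_smul, norm_neg, Real.norm_of_nonneg ht.le]
    have ht1 : t * n ≤ ρ / 2 := by
      have := mul_le_mul_of_nonneg_right (min_le_left (ρ / 2 / n) 1) hn0.le
      rwa [div_mul_cancel₀ _ hn0.ne'] at this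
    have h4 := @hball (z + -t • (z - z0)) (by
      rw [dist_eq_norm, add_sub_cancel_left, htn]; linarith)
    rw [add_sub_cancel_left, htn] at h4
    have h5 : φ (z + -t • (z - z0)) = (R + 1) * ((1 - t) * n) := by
      simp only [hφ]
      have : z + -t • (z - z0) - z0 = (1 - t) • (z - z0) := by module
      rw [this, norm_smul, Real.norm_of_nonneg (by linarith [min_le_right (ρ / 2 / n) 1])]
    have h6 := (abs_le.1 (abs_real_inner_le_norm (gradient φ z) (-t • (z - z0)))).1
    rw [htn] at h6
    have h7 := (abs_le.1 h4).2
    have h7' := (abs_le.1 h4).1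
    rw [h5] at h7 h7'
    have h8 : φ z = (R + 1) * n := rfl
    have h9 : ‖gradient φ z‖ * (t * n) ≤ R * (t * n) :=
      mul_le_mul_of_nonneg_right h2 (by positivity)
    have h10 : 0 < t * n := by positivity
    nlinarith
  rw [hzz] at hmax h0 hzb
  by_cases hin : z0' ∈ closedBall z0 r
  · have h1 : liftComp u i z0' - φ z0' ≤ liftComp u i z0 - φ z0 := hmax hin
    simp only [hφ, liftComp, sub_self, norm_zero, mul_zero, sub_zero] at h1
    linarith
  · rw [mem_closedBall, dist_eq_norm, not_le] at hin
    have h1 := (abs_le.1 (hM z0)).1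
    have h2 := (abs_le.1 (hM z0')).2
    simp only [liftComp] at h1 h2
    nlinarith

end System

end WeaklyCoupled

namespace WeaklyCoupled

open Filter Metric Set MeasureTheory

/-! ### Mollification with a variable radius -/

section Mollify

variable {N : ℕ}

/-- A bump function on `ℝ^N` supported in the unit ball. -/
noncomputable def unitBump (N : ℕ) : ContDiffBump (0 : Eucl N) :=
  ⟨1 / 2, 1, by norm_num, by norm_num⟩

/-- A smooth probability density supported in the unit ball. -/
noncomputable def kernel (N : ℕ) : Eucl N → ℝ := (unitBump N).normed volume

/-- The probability measure with density `kernel N`. -/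
noncomputable def kernelMeasure (N : ℕ) : Measure (Eucl N) :=
  volume.withDensity fun y => ((kernel N y).toNNReal : ENNReal)

lemma kernel_nonneg (y : Eucl N) : 0 ≤ kernel N y := (unitBump N).nonneg_normed y

lemma contDiff_kernel : ContDiff ℝ ∞ (kernel N) := (unitBump N).contDiff_normed

lemma kernel_eq_zero {y : Eucl N} (hy : 1 ≤ ‖y‖) : kernel N y = 0 := by
  have h := (unitBump N).support_normed_eq (μ := (volume : Measure (Eucl N)))
  by_contra hne
  have : y ∈ Function.support ((unitBump N).normed volume) := hne
  rw [h, mem_ball_zero_iff] at this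
  exact absurd this (not_lt.2 hy)

instance : IsProbabilityMeasure (kernelMeasure N) := by
  refine ⟨?_⟩
  have h1 : ∫⁻ y : Eucl N, ENNReal.ofReal (kernel N y) =
      ENNReal.ofReal (∫ y : Eucl N, kernel N y) :=
    (ofReal_integral_eq_lintegral_ofReal (unitBump N).integrable_normed
      (.of_forall kernel_nonneg)).symm
  have h2 : ∫ y : Eucl N, kernel N y = 1 := (unitBump N).integral_normed
  rw [h2, ENNReal.ofReal_one] at h1
  rw [kernelMeasure, withDensity_apply _ MeasurableSet.univ, Measure.restrict_univ]
  exact h1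

lemma measurable_kernel : Measurable fun y : Eucl N => (kernel N y).toNNReal :=
  contDiff_kernel.continuous.measurable.real_toNNReal

lemma ae_kernelMeasure_norm_le : ∀ᵐ y ∂kernelMeasure N, ‖y‖ ≤ 1 := by
  rw [kernelMeasure, ae_withDensity_iff measurable_kernel.coe_nnreal_ennreal]
  refine .of_forall fun y hy => ?_
  by_contra! hlt
  exact hy (by simp [kernel_eq_zero hlt.le])

lemma integral_kernelMeasure (g : Eucl N → ℝ) :
    ∫ y, g y ∂kernelMeasure N = ∫ y, kernel N y * g y := by
  rw [kernelMeasure, integral_withDensity_eq_integral_smul measurable_kernel]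
  refine integral_congr_ae (.of_forall fun y => ?_)
  simp [NNReal.smul_def, kernel_nonneg]

/-- Lets almost everywhere information about `v` be used under the averaging integral; it fails for
`r = 0`, where all the mass sits at `z₀`. -/
lemma ae_kernelMeasure_of_ae {P : Eucl N → Prop} (h : ∀ᵐ z, P z) (z₀ : Eucl N) {r : ℝ}
    (hr : r ≠ 0) : ∀ᵐ y ∂kernelMeasure N, P (z₀ - r • y) := by
  have hac : kernelMeasure N ≪ volume := withDensity_absolutelyContinuous _ _
  refine hac.ae_le ?_
  have h1 : Measure.QuasiMeasurePreserving (fun y : Eucl N => z₀ - r • y) volume volume :=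
    (Measure.measurePreserving_sub_left volume z₀).quasiMeasurePreserving.comp
      (Measure.quasiMeasurePreserving_smul _ hr)
  exact h1.ae h

/-- The average of `v` at `x` with respect to the kernel rescaled by `r x`. -/
noncomputable def mollify (v r : Torus N → ℝ) (x : Torus N) : ℝ :=
  ∫ y, v (x - proj (r x • y)) ∂kernelMeasure N

lemma mollify_proj (v r : Torus N → ℝ) (z : Eucl N) :
    mollify v r (proj z) = ∫ y, v (proj (z - r (proj z) • y)) ∂kernelMeasure N := by
  simp only [mollify, proj_sub]

lemma exists_abs_le_of_continuous {v : Torus N → ℝ} (hv : Continuous v) :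
    ∃ M, 0 ≤ M ∧ ∀ x, |v x| ≤ M := by
  obtain ⟨M, hM⟩ := (isCompact_univ (X := Torus N)).exists_bound_of_continuousOn hv.continuousOn
  exact ⟨|M|, abs_nonneg _, fun x => (hM x (mem_univ _)).trans (le_abs_self _)⟩

lemma integrable_comp_of_continuous {v : Torus N → ℝ} (hv : Continuous v) {f : Eucl N → Torus N}
    (hf : Continuous f) : Integrable (fun y => v (f y)) (kernelMeasure N) := by
  obtain ⟨M, -, hM⟩ := exists_abs_le_of_continuous hv
  exact Integrable.of_bound (hv.comp hf).aestronglyMeasurable M (.of_forall fun y => hM _)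

lemma abs_mollify_sub_le {v r : Torus N → ℝ} (hv : Continuous v) {L : ℝ} (hL0 : 0 ≤ L)
    (hL : ∀ z z' : Eucl N, v (proj z) ≤ v (proj z') + L * ‖z - z'‖) {x : Torus N} (hr : 0 ≤ r x) :
    |mollify v r x - v x| ≤ L * r x := by
  obtain ⟨z, rfl⟩ := proj_surjective x
  have hint : Integrable (fun y => v (proj (z - r (proj z) • y))) (kernelMeasure N) :=
    integrable_comp_of_continuous hv (continuous_proj.comp (by fun_prop))
  have h1 : mollify v r (proj z) - v (proj z) =
      ∫ y, (v (proj (z - r (proj z) • y)) - v (proj z)) ∂kernelMeasure N := by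
    rw [integral_sub hint (integrable_const _), mollify_proj]; simp
  rw [h1, ← Real.norm_eq_abs]
  refine (norm_integral_le_of_norm_le_const (C := L * r (proj z)) ?_).trans (by simp)
  filter_upwards [ae_kernelMeasure_norm_le] with y hy
  have h2 := hL (z - r (proj z) • y) z
  have h3 := hL z (z - r (proj z) • y)
  rw [sub_sub_cancel_left, norm_neg, norm_smul, Real.norm_of_nonneg hr] at h2
  rw [sub_sub_cancel, norm_smul, Real.norm_of_nonneg hr] at h3
  have h4 : L * (r (proj z) * ‖y‖) ≤ L * r (proj z) :=
    mul_le_mul_of_nonneg_left (mul_le_of_le_one_right hr hy) hL0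
  rw [Real.norm_eq_abs, abs_le]; constructor <;> linarith

lemma continuous_mollify {v r : Torus N → ℝ} (hv : Continuous v) (hr : Continuous r) :
    Continuous (mollify v r) := by
  obtain ⟨M, -, hM⟩ := exists_abs_le_of_continuous hv
  refine continuous_of_dominated (bound := fun _ => M) (fun x => ?_) (fun x => .of_forall fun y =>
    hM _) (integrable_const _) (.of_forall fun y => ?_)
  · exact (hv.comp (continuous_const.sub (continuous_proj.comp (by fun_prop)))).aestronglyMeasurable
  · exact hv.comp (continuous_id.sub (continuous_proj.comp (hr.smul continuous_const)))

/-- The substitution `t = s • y` moves the radius from the argument of `v`, which is merely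
continuous, into the kernel, which is smooth in `(s, t)` for `s > 0`. What remains is a convolution
with a parameter, composed with `z ↦ (r (proj z), z)`. -/
lemma contDiffAt_mollify {v r : Torus N → ℝ} (hv : Continuous v) {z₀ : Eucl N}
    (hr : ContDiffAt ℝ ∞ (fun z => r (proj z)) z₀) (hpos : 0 < r (proj z₀)) :
    ContDiffAt ℝ ∞ (fun z => mollify v r (proj z)) z₀ := by
  set f : Eucl N → ℝ := fun z => v (proj z)
  have hf : Continuous f := hv.comp continuous_proj
  set s₀ := r (proj z₀)
  set g : ℝ → Eucl N → ℝ := fun s t => (s ^ N)⁻¹ * kernel N (s⁻¹ • t) with hg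
  set F : ℝ × Eucl N → ℝ := fun q =>
    (f ⋆[ContinuousLinearMap.mul ℝ ℝ, volume] g q.1) q.2 with hF
  -- Bounding the parameter by `s₀ + 1` puts all the kernels in one compact ball.
  have hFs : ContDiffOn ℝ ∞ F (Ioo 0 (s₀ + 1) ×ˢ univ) := by
    refine contDiffOn_convolution_right_with_param (n := ⊤) _ isOpen_Ioo
      (isCompact_closedBall (0 : Eucl N) (s₀ + 1)) ?_ hf.locallyIntegrable ?_
    · intro s t hs ht
      rw [mem_closedBall_zero_iff, not_le] at ht
      simp only [hg]
      rw [kernel_eq_zero, mul_zero]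
      rw [norm_smul, norm_inv, Real.norm_of_nonneg hs.1.le, ← div_eq_inv_mul, one_le_div hs.1]
      linarith [hs.2]
    · have h1 : ContDiffOn ℝ ∞ (fun q : ℝ × Eucl N => q.1⁻¹) (Ioo 0 (s₀ + 1) ×ˢ univ) :=
        contDiff_fst.contDiffOn.inv fun q hq => hq.1.1.ne'
      have h2 : ContDiffOn ℝ ∞ (fun q : ℝ × Eucl N => (q.1 ^ N)⁻¹) (Ioo 0 (s₀ + 1) ×ˢ univ) :=
        (contDiff_fst.pow N).contDiffOn.inv fun q hq => pow_ne_zero _ hq.1.1.ne'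
      exact h2.mul (contDiff_kernel.comp_contDiffOn (h1.smul contDiff_snd.contDiffOn))
  have hFeq : ∀ s z, 0 < s → F (s, z) = ∫ y, v (proj (z - s • y)) ∂kernelMeasure N := by
    intro s z hs
    simp only [hF]
    rw [convolution_eq_swap, integral_kernelMeasure]
    have h1 := Measure.integral_comp_smul (volume : Measure (Eucl N))
      (fun y => kernel N y * f (z - s • y)) s⁻¹
    simp only [smul_inv_smul₀ hs.ne', finrank_euclideanSpace, Fintype.card_fin, smul_eq_mul,
      inv_pow, inv_inv] at h1
    rw [abs_of_pos (by positivity)] at h1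
    have h2 : ∫ t, (ContinuousLinearMap.mul ℝ ℝ) (f (z - t)) (g s t) =
        (s ^ N)⁻¹ * ∫ t, kernel N (s⁻¹ • t) * f (z - t) := by
      rw [← integral_const_mul]
      refine integral_congr_ae (.of_forall fun t => ?_)
      simp only [ContinuousLinearMap.mul_apply', hg]; ring
    rw [h2, h1, inv_mul_cancel_left₀ (by positivity)]
  have hev : (fun z => mollify v r (proj z)) =ᶠ[𝓝 z₀] fun z => F (r (proj z), z) := by
    filter_upwards [hr.continuousAt.eventually (lt_mem_nhds hpos)] with z hz
    rw [hFeq _ _ hz, mollify_proj]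
  refine ContDiffAt.congr_of_eventuallyEq ?_ hev
  have hFat : ContDiffAt ℝ ∞ F (r (proj z₀), z₀) :=
    hFs.contDiffAt ((isOpen_Ioo.prod isOpen_univ).mem_nhds
      ⟨⟨hpos, lt_add_one s₀⟩, mem_univ _⟩)
  exact ContDiffAt.comp (f := fun z => (r (proj z), z)) z₀ hFat (hr.prodMk contDiffAt_id)

lemma ae_hasGradientAt_of_lipschitz {f : Eucl N → ℝ} {L : ℝ} (hL0 : 0 ≤ L)
    (hL : ∀ z z', f z ≤ f z' + L * ‖z - z'‖) :
    ∀ᵐ z, ∃ p, HasGradientAt f p z ∧ ‖p‖ ≤ L := by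
  have h : LipschitzWith L.toNNReal f := by
    refine LipschitzWith.of_dist_le_mul fun z z' => ?_
    rw [dist_eq_norm, dist_eq_norm, Real.norm_eq_abs, abs_le]
    have h1 := hL z z'
    have h2 := hL z' z
    rw [norm_sub_rev] at h2
    rw [Real.coe_toNNReal _ hL0]
    constructor <;> linarith
  filter_upwards [h.ae_differentiableAt] with z hz
  exact ⟨_, hz.hasGradientAt, hz.hasGradientAt.frechetSuper.norm_le hL0 hL⟩

/-- The gradient of a mollified function is an average of the gradients of the function, corrected
by a multiple of the gradient of the radius. -/
lemma exists_hasGradientAt_mollify {v r : Torus N → ℝ} (hv : Continuous v) {L : ℝ} (hL0 : 0 ≤ L)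
    (hL : ∀ z z' : Eucl N, v (proj z) ≤ v (proj z') + L * ‖z - z'‖) {z₀ g : Eucl N}
    (hpos : 0 < r (proj z₀)) (hg : HasGradientAt (fun z => r (proj z)) g z₀) :
    ∃ q, HasGradientAt (fun z => mollify v r (proj z)) q z₀ ∧
      ∀ C : Set (Eucl N), Convex ℝ C → IsClosed C →
        (∀ᵐ z, ‖z - z₀‖ ≤ r (proj z₀) → ∀ p, HasGradientAt (fun z => v (proj z)) p z →
          ‖p‖ ≤ L → ∀ s : ℝ, |s| ≤ L → p - s • g ∈ C) → q ∈ C := by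
  set f : Eucl N → ℝ := fun z => v (proj z) with hfdef
  have hf : Continuous f := hv.comp continuous_proj
  set R : Eucl N → ℝ := fun z => r (proj z) with hR
  set ν := kernelMeasure N with hν
  have hLabs : ∀ z z', |f z - f z'| ≤ L * ‖z - z'‖ := by
    intro z z'
    have h1 := hL z z'
    have h2 := hL z' z
    rw [norm_sub_rev] at h2
    simp only [hfdef]
    rw [abs_le]; constructor <;> linarith
  have hdiff : ∀ᵐ y ∂ν, ∃ p, HasGradientAt f p (z₀ - R z₀ • y) ∧ ‖p‖ ≤ L :=
    ae_kernelMeasure_of_ae (ae_hasGradientAt_of_lipschitz hL0 hL) z₀ hpos.ne'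
  set G : Eucl N → Eucl N := fun y => gradient f (z₀ - R z₀ • y) with hG
  -- Chain rule for `z ↦ f (z - R z • y)`: the moving radius contributes the multiple `inner (G y)
  -- y` of `g`.
  set Q : Eucl N → Eucl N := fun y => G y - (inner ℝ (G y) y) • g with hQ
  have hGm : Measurable G := by
    have h1 : Measurable (gradient f) :=
      (LinearIsometryEquiv.continuous _).measurable.comp (measurable_fderiv ℝ f)
    exact h1.comp (by fun_prop : Continuous fun y : Eucl N => z₀ - R z₀ • y).measurable
  have hQm : AEStronglyMeasurable Q ν :=
    (hGm.sub ((hGm.inner measurable_id).smul_const g)).aestronglyMeasurable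
  have hQint : Integrable Q ν := by
    refine Integrable.of_bound hQm (L + L * ‖g‖) ?_
    filter_upwards [hdiff, ae_kernelMeasure_norm_le] with y ⟨p, hp, hpL⟩ hy
    have hGy : G y = p := hp.gradient
    simp only [hQ, hGy]
    refine (norm_sub_le _ _).trans (add_le_add hpL ?_)
    rw [norm_smul]
    refine mul_le_mul_of_nonneg_right ?_ (norm_nonneg _)
    refine (norm_inner_le_norm p y).trans ?_
    nlinarith [norm_nonneg p, norm_nonneg y]
  obtain ⟨δ, hδ, hball⟩ := Metric.eventually_nhds_iff_ball.1
    (hg.eventually_abs_le (ε := 1) one_pos)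
  have hder := hasFDerivAt_integral_of_dominated_loc_of_lip' (μ := ν) (𝕜 := ℝ)
    (F := fun z y => f (z - R z • y)) (F' := fun y => innerSL ℝ (Q y)) (x₀ := z₀)
    (bound := fun _ => L * (1 + (‖g‖ + 1))) (ball_mem_nhds z₀ hδ)
    (fun z _ => (hf.comp (by fun_prop)).aestronglyMeasurable)
    (integrable_comp_of_continuous hv (continuous_proj.comp (by fun_prop)))
    ((innerSL ℝ).continuous.comp_aestronglyMeasurable hQm)
    (by
      filter_upwards [ae_kernelMeasure_norm_le] with y hy z hz
      rw [Real.norm_eq_abs]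
      refine (hLabs _ _).trans ?_
      rw [mul_assoc]
      refine mul_le_mul_of_nonneg_left ?_ hL0
      have h1 : z - R z • y - (z₀ - R z₀ • y) = (z - z₀) - (R z - R z₀) • y := by module
      rw [h1]
      refine (norm_sub_le _ _).trans ?_
      rw [add_mul, one_mul]
      refine add_le_add le_rfl ?_
      rw [norm_smul, Real.norm_eq_abs]
      have h2 : |R z - R z₀| ≤ (‖g‖ + 1) * ‖z - z₀‖ := by
        have h3 := abs_le.1 (hball z hz)
        have h4 := abs_le.1 (abs_real_inner_le_norm g (z - z₀))
        rw [abs_le]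
        constructor <;> linarith [h3.1, h3.2, h4.1, h4.2]
      calc |R z - R z₀| * ‖y‖ ≤ |R z - R z₀| := mul_le_of_le_one_right (abs_nonneg _) hy
        _ ≤ _ := h2)
    (integrable_const _)
    (by
      filter_upwards [hdiff] with y ⟨p, hp, _⟩
      have hGy : G y = p := hp.gradient
      have h1 : HasFDerivAt (fun z => z - R z • y) (ContinuousLinearMap.id ℝ (Eucl N) -
          ((InnerProductSpace.toDual ℝ (Eucl N)) g).smulRight y) z₀ :=
        (hasFDerivAt_id z₀).sub (hg.hasFDerivAt.smul_const y)
      have h2 := HasFDerivAt.comp (f := fun z => z - R z • y) z₀ hp.hasFDerivAt h1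
      refine h2.congr_fderiv ?_
      ext w
      simp only [hQ, hGy, ContinuousLinearMap.comp_apply, sub_apply, ContinuousLinearMap.id_apply,
        ContinuousLinearMap.smulRight_apply, InnerProductSpace.toDual_apply_apply,
        innerSL_apply_apply, inner_sub_left, inner_sub_right, inner_smul_left, inner_smul_right,
        RCLike.conj_to_real]
      ring)
  refine ⟨∫ y, Q y ∂ν, ?_, fun C hC hCc hae => ?_⟩
  · rw [hasGradientAt_iff_hasFDerivAt]
    have h1 := (innerSL ℝ (E := Eucl N)).integral_comp_comm hQint
    have h2 := hder.2
    rw [h1] at h2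
    simp only [mollify_proj]
    exact h2
  -- Jensen's inequality in set form: the mean of a probability measure carried by a closed convex
  -- set lies in that set.
  · refine hC.integral_mem hCc ?_ hQint
    filter_upwards [hdiff, ae_kernelMeasure_norm_le, ae_kernelMeasure_of_ae hae z₀ hpos.ne']
      with y ⟨p, hp, hpL⟩ hy hP
    have hGy : G y = p := hp.gradient
    simp only [hQ, hGy]
    refine hP ?_ p hp hpL _ ?_
    · rw [sub_sub_cancel_left, norm_neg, norm_smul, Real.norm_of_nonneg hpos.le]
      exact mul_le_of_le_one_right hpos.le hy
    · refine (abs_real_inner_le_norm p y).trans ?_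
      nlinarith [norm_nonneg p, norm_nonneg y]

end Mollify

end WeaklyCoupled

namespace WeaklyCoupled

open Filter Metric Set MeasureTheory

/-! ### Mollified subsolutions and the almost everywhere characterization -/

section Mollify

variable {N m : ℕ} {H : Fin m → Torus N → Eucl N → ℝ}
  {B : Torus N → Matrix (Fin m) (Fin m) ℝ}

lemma exists_pos_forall_le {ι : Type*} [Finite ι] {η : ι → ℝ} (h : ∀ i, 0 < η i) :
    ∃ c, 0 < c ∧ ∀ i, c ≤ η i := by
  rcases isEmpty_or_nonempty ι with hι | hι
  · exact ⟨1, one_pos, fun i => isEmptyElim i⟩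
  · obtain ⟨i, hi⟩ := Finite.exists_min η
    exact ⟨η i, h i, hi⟩

lemma exists_modulus {F : Type*} [NormedAddCommGroup F] [ProperSpace F] {h : Torus N × F → ℝ}
    (hc : Continuous h) (R : ℝ) {ε : ℝ} (hε : 0 < ε) :
    ∃ η, 0 < η ∧ ∀ x x' q q', ‖q‖ ≤ R → ‖q'‖ ≤ R → dist x x' ≤ η → ‖q - q'‖ ≤ η →
      |h (x, q) - h (x', q')| ≤ ε := by
  have hK : IsCompact ((univ : Set (Torus N)) ×ˢ closedBall (0 : F) R) :=
    isCompact_univ.prod (isCompact_closedBall _ _)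
  obtain ⟨δ, hδ, hunif⟩ := Metric.uniformContinuousOn_iff.1
    (hK.uniformContinuousOn_of_continuous hc.continuousOn) ε hε
  refine ⟨δ / 2, by positivity, fun x x' q q' hq hq' hx hqq => ?_⟩
  have := hunif (x, q) ⟨mem_univ _, by simpa using hq⟩ (x', q') ⟨mem_univ _, by simpa using hq'⟩ (by
    rw [Prod.dist_eq, dist_eq_norm q]
    exact (max_le hx hqq).trans_lt (half_lt_self hδ))
  exact this.le

/-- Componentwise mollification. -/
noncomputable def mollifyVec (u : Torus N → Fin m → ℝ) (r : Torus N → ℝ) (x : Torus N) :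
    Fin m → ℝ := fun i => mollify (fun y => u y i) r x

lemma exists_norm_le_of_continuous {u : Torus N → Fin m → ℝ} (hu : Continuous u) :
    ∃ M, 0 ≤ M ∧ ∀ x, ‖u x‖ ≤ M := by
  obtain ⟨M, hM⟩ := (isCompact_univ (X := Torus N)).exists_bound_of_continuousOn hu.continuousOn
  exact ⟨|M|, abs_nonneg _, fun x => (hM x (mem_univ _)).trans (le_abs_self _)⟩

lemma norm_mollifyVec_sub_le {u : Torus N → Fin m → ℝ} {r : Torus N → ℝ} (hu : Continuous u)
    {L : ℝ} (hL0 : 0 ≤ L)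
    (hL : ∀ i (z z' : Eucl N), u (proj z) i ≤ u (proj z') i + L * ‖z - z'‖) {x : Torus N}
    (hr : 0 ≤ r x) : ‖mollifyVec u r x - u x‖ ≤ L * r x :=
  (pi_norm_le_iff_of_nonneg (mul_nonneg hL0 hr)).2 fun i =>
    abs_mollify_sub_le ((continuous_apply i).comp hu) hL0 (hL i) hr

/-- Mollification with a small and slowly varying radius almost preserves the inequalities
satisfied almost everywhere. -/
lemma Admissible.exists_lhs_mollifyVec_le (S : Admissible H B) {u : Torus N → Fin m → ℝ}
    (hu : Continuous u) {L : ℝ} (hL0 : 0 ≤ L)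
    (hL : ∀ i (z z' : Eucl N), u (proj z) i ≤ u (proj z') i + L * ‖z - z'‖) {ε : ℝ} (hε : 0 < ε) :
    ∃ h, 0 < h ∧ ∀ (r : Torus N → ℝ) (z₀ g : Eucl N), 0 < r (proj z₀) → r (proj z₀) ≤ h →
      HasGradientAt (fun z => r (proj z)) g z₀ → ‖g‖ ≤ h → ∀ i a,
      (∀ᵐ z, ‖z - z₀‖ ≤ r (proj z₀) →
        ∃ p, HasGradientAt (liftComp u i) p z ∧ lhs H B u i (proj z) p ≤ a) →
      ∃ q, HasGradientAt (liftComp (mollifyVec u r) i) q z₀ ∧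
        lhs H B (mollifyVec u r) i (proj z₀) q ≤ a + ε := by
  obtain ⟨M, hM0, hM⟩ := exists_norm_le_of_continuous hu
  choose η₁ hη₁ hmod₁ using fun i =>
    exists_modulus (S.continuous_ham i) (L + L) (half_pos hε)
  have hBc : ∀ i, Continuous fun z : Torus N × (Fin m → ℝ) => (B z.1).mulVec z.2 i := fun i =>
    (continuous_apply i).comp ((S.cont.comp continuous_fst).matrix_mulVec continuous_snd)
  choose η₂ hη₂ hmod₂ using fun i => exists_modulus (hBc i) (M + L) (half_pos hε)
  obtain ⟨c₁, hc₁, hle₁⟩ := exists_pos_forall_le hη₁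
  obtain ⟨c₂, hc₂, hle₂⟩ := exists_pos_forall_le hη₂
  set c := min c₁ c₂
  have hc : 0 < c := lt_min hc₁ hc₂
  -- The three displacements are at most `h` in position, `L * h` in slope and `2 * L * h` in value,
  -- all within the modulus `c`; `h ≤ 1` keeps slopes below `2 * L` and values below `M + L`.
  set h := min 1 (c / (2 * L + 1)) with hh
  have hh0 : 0 < h := by positivity
  have hh1 : h ≤ 1 := min_le_left _ _
  have hhc : h * (2 * L + 1) ≤ c := by
    rw [← le_div_iff₀ (by positivity)]; exact min_le_right _ _
  have hLh : 0 ≤ L * h := by positivity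
  refine ⟨h, hh0, fun r z₀ g hr0 hrh hg hgh i a hae => ?_⟩
  obtain ⟨q, hq, hmem⟩ := exists_hasGradientAt_mollify (v := fun y => u y i)
    ((continuous_apply i).comp hu) hL0 (hL i) hr0 hg
  refine ⟨q, hq, ?_⟩
  set W := (B (proj z₀)).mulVec (mollifyVec u r (proj z₀)) i with hW
  have hwu : ∀ z, ‖mollifyVec u r (proj z₀) - u (proj z)‖ ≤ L * h + L * ‖z - z₀‖ := by
    intro z
    have h1 : ‖mollifyVec u r (proj z₀) - u (proj z₀)‖ ≤ L * h :=
      (norm_mollifyVec_sub_le hu hL0 hL hr0.le).trans (mul_le_mul_of_nonneg_left hrh hL0)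
    have h2 : ‖u (proj z₀) - u (proj z)‖ ≤ L * ‖z - z₀‖ := by
      refine (pi_norm_le_iff_of_nonneg (by positivity)).2 fun j => ?_
      have e1 := hL j z z₀
      have e2 := hL j z₀ z
      rw [norm_sub_rev] at e2
      rw [Pi.sub_apply, Real.norm_eq_abs, abs_le]
      constructor <;> linarith
    calc _ = ‖(mollifyVec u r (proj z₀) - u (proj z₀)) + (u (proj z₀) - u (proj z))‖ := by
          congr 1; abel
      _ ≤ _ := (norm_add_le _ _).trans (add_le_add h1 h2)
  have hwM : ‖mollifyVec u r (proj z₀)‖ ≤ M + L := by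
    have h1 := hwu z₀
    simp only [sub_self, norm_zero, mul_zero, add_zero] at h1
    calc _ = ‖u (proj z₀) + (mollifyVec u r (proj z₀) - u (proj z₀))‖ := by congr 1; abel
      _ ≤ M + L := (norm_add_le _ _).trans (add_le_add (hM _) (by nlinarith))
  -- The sublevel set of `H i (proj z₀)` is closed and convex, so it contains `q` as soon as it
  -- contains the corrected gradients at almost every nearby point.
  have hq' : q ∈ {p | H i (proj z₀) p ≤ a + ε - W} := by
    refine hmem _ ?_ ?_ ?_
    · have := (S.ham i).convex (proj z₀) |>.convex_le (a + ε - W)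
      simpa using this
    · exact isClosed_le ((S.continuous_ham i).comp (Continuous.prodMk_right (proj z₀)))
        continuous_const
    · filter_upwards [hae] with z hz hzr p hp hpL s hs
      have hzh : ‖z - z₀‖ ≤ h := hzr.trans hrh
      obtain ⟨p', hp', hlhs⟩ := hz hzr
      have hpp : p' = p := hp'.unique hp
      subst hpp
      have hsg : ‖s • g‖ ≤ L * h := by
        rw [norm_smul, Real.norm_eq_abs]
        exact mul_le_mul hs hgh (norm_nonneg _) hL0
      have hdist : dist (proj z₀) (proj z) ≤ h := by
        rw [dist_comm]; exact (dist_proj_le z z₀).trans hzh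
      have b1 := hmod₁ i (proj z₀) (proj z) (p' - s • g) p'
        ((norm_sub_le _ _).trans (add_le_add hpL (hsg.trans (by nlinarith)))) (by linarith)
        (hdist.trans ((by nlinarith : h ≤ c).trans ((min_le_left _ _).trans (hle₁ i))))
        (by rw [sub_sub_cancel_left, norm_neg]
            exact hsg.trans ((by nlinarith : L * h ≤ c).trans ((min_le_left _ _).trans (hle₁ i))))
      have b2 := hmod₂ i (proj z₀) (proj z) (mollifyVec u r (proj z₀)) (u (proj z)) hwM
        ((hM _).trans (by linarith))
        (hdist.trans ((by nlinarith : h ≤ c).trans ((min_le_right _ _).trans (hle₂ i))))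
        ((hwu z).trans ((by nlinarith : L * h + L * ‖z - z₀‖ ≤ c).trans
          ((min_le_right _ _).trans (hle₂ i))))
      have b1 := (abs_le.1 b1).2
      have b2 := (abs_le.1 b2).2
      simp only [lhs] at hlhs b1 b2
      change H i (proj z₀) (p' - s • g) ≤ a + ε - W
      linarith
  have hq'' : H i (proj z₀) q ≤ a + ε - W := hq'
  simp only [lhs]
  linarith

lemma Admissible.isSubsolution_of_hasGradientAt (S : Admissible H B) {u : Torus N → Fin m → ℝ}
    (hu : Continuous u) {a : ℝ}
    (h : ∀ i z, ∃ p, HasGradientAt (liftComp u i) p z ∧ lhs H B u i (proj z) p ≤ a) :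
    IsSubsolution H B (fun _ => a) u := by
  refine S.isSubsolution_iff.2 ⟨hu, fun i x p hp => ?_⟩
  obtain ⟨q, hq, hle⟩ := h i x
  rwa [hq.eq_of_frechetSuper hp]

lemma continuous_mollifyVec {u : Torus N → Fin m → ℝ} {r : Torus N → ℝ} (hu : Continuous u)
    (hr : Continuous r) : Continuous (mollifyVec u r) :=
  continuous_pi fun i => continuous_mollify ((continuous_apply i).comp hu) hr

/-- Lipschitz almost everywhere subsolutions are viscosity subsolutions. -/
lemma Admissible.isSubsolution_of_ae (S : Admissible H B) {u : Torus N → Fin m → ℝ}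
    (hu : Continuous u) {L : ℝ} (hL0 : 0 ≤ L)
    (hL : ∀ i (z z' : Eucl N), u (proj z) i ≤ u (proj z') i + L * ‖z - z'‖) {a : ℝ}
    (hae : ∀ i, ∀ᵐ z, ∃ p, HasGradientAt (liftComp u i) p z ∧ lhs H B u i (proj z) p ≤ a) :
    IsSubsolution H B (fun _ => a) u := by
  refine S.isSubsolution_of_approx hu fun x i η hη => ?_
  -- A constant radius suffices: the mollified function is differentiable everywhere, is a
  -- subsolution at level `a + η`, and is uniformly close to `u`.
  obtain ⟨h, hh0, hh⟩ := S.exists_lhs_mollifyVec_le hu hL0 hL hη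
  set r : ℝ := min h (η / (L + 1))
  have hr0 : 0 < r := by positivity
  have hLr : L * r ≤ η := by
    have : r * (L + 1) ≤ η := by
      rw [← le_div_iff₀ (by positivity)]; exact min_le_right _ _
    nlinarith
  have hclose : ∀ y j, |mollifyVec u (fun _ => r) y j - u y j| ≤ η := fun y j =>
    ((norm_le_pi_norm (mollifyVec u (fun _ => r) y - u y) j).trans
      (norm_mollifyVec_sub_le hu hL0 hL hr0.le)).trans hLr
  refine ⟨mollifyVec u fun _ => r, S.isSubsolution_of_hasGradientAt
    (continuous_mollifyVec hu continuous_const) fun j z => ?_, fun y j => ?_, ?_⟩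
  · refine hh (fun _ => r) z 0 hr0 (min_le_left _ _) (hasGradientAt_const _ _)
      (by simpa using hh0.le) j a ?_
    filter_upwards [hae j] with y hy _ using hy
  · linarith [(abs_le.1 (hclose y j)).2]
  · linarith [(abs_le.1 (hclose x i)).1]

lemma Admissible.ae_of_isSubsolution (S : Admissible H B) {u : Torus N → Fin m → ℝ} {L : ℝ}
    (hL0 : 0 ≤ L) (hL : ∀ i (z z' : Eucl N), u (proj z) i ≤ u (proj z') i + L * ‖z - z'‖) {a : ℝ}
    (hu : IsSubsolution H B (fun _ => a) u) (i : Fin m) :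
    ∀ᵐ z, ∃ p, HasGradientAt (liftComp u i) p z ∧ lhs H B u i (proj z) p ≤ a := by
  filter_upwards [ae_hasGradientAt_of_lipschitz hL0 (hL i)] with z ⟨p, hp, _⟩
  exact ⟨p, hp, (S.isSubsolution_iff.1 hu).2 i z p hp.frechetSuper⟩

/-! ### Convex combinations -/

lemma Admissible.lhs_convex_comb (S : Admissible H B) {u v : Torus N → Fin m → ℝ} {s t : ℝ}
    (hs : 0 ≤ s) (ht : 0 ≤ t) (hst : s + t = 1) (i : Fin m) {z p q : Eucl N}
    (hp : HasGradientAt (liftComp u i) p z) (hq : HasGradientAt (liftComp v i) q z) :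
    HasGradientAt (liftComp (s • u + t • v) i) (s • p + t • q) z ∧
      lhs H B (s • u + t • v) i (proj z) (s • p + t • q) ≤
        s * lhs H B u i (proj z) p + t * lhs H B v i (proj z) q := by
  constructor
  · rw [hasGradientAt_iff_hasFDerivAt] at *
    have := (hp.const_mul s).add (hq.const_mul t)
    rw [map_add, map_smul, map_smul]
    exact this
  · have h1 := ((S.ham i).convex (proj z)).2 (mem_univ p) (mem_univ q) hs ht hst
    simp only [lhs, Pi.add_apply, Pi.smul_apply, Matrix.mulVec_add, Matrix.mulVec_smul,
      smul_eq_mul] at h1 ⊢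
    linarith

/-- A supergradient of a sum need not split into supergradients of the summands, so the argument
runs through points where both functions are differentiable, which is almost everywhere. -/
lemma Admissible.isSubsolution_convex_comb (S : Admissible H B) {u v : Torus N → Fin m → ℝ}
    (hu : IsSubsolution H B (fun _ => 0) u) (hv : IsSubsolution H B (fun _ => 0) v) {s t : ℝ}
    (hs : 0 ≤ s) (ht : 0 ≤ t) (hst : s + t = 1) :
    IsSubsolution H B (fun _ => 0) (s • u + t • v) := by
  obtain ⟨C, L, -, hL0, hbd⟩ := S.exists_bounds
  have hu' := (hbd u (hu.mono zero_le_one)).2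
  have hv' := (hbd v (hv.mono zero_le_one)).2
  refine S.isSubsolution_of_ae ((hu.1.const_smul s).add (hv.1.const_smul t)) hL0
    (fun i z z' => ?_) fun i => ?_
  · have e1 := mul_le_mul_of_nonneg_left (hu' i z z') hs
    have e2 := mul_le_mul_of_nonneg_left (hv' i z z') ht
    simp only [Pi.add_apply, Pi.smul_apply, smul_eq_mul]
    have : L * ‖z - z'‖ = s * (L * ‖z - z'‖) + t * (L * ‖z - z'‖) := by
      rw [← add_mul, hst, one_mul]
    linarith
  · filter_upwards [S.ae_of_isSubsolution hL0 hu' hu i, S.ae_of_isSubsolution hL0 hv' hv i]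
      with z ⟨p, hp, hple⟩ ⟨q, hq, hqle⟩
    obtain ⟨h1, h2⟩ := S.lhs_convex_comb hs ht hst i hp hq
    exact ⟨_, h1, h2.trans (by nlinarith)⟩

/-- A convex combination of a strict subsolution with a subsolution is strict. -/
lemma Admissible.isStrictCompAt_convex_comb (S : Admissible H B) {u v : Torus N → Fin m → ℝ}
    (hu : IsSubsolution H B (fun _ => 0) u) {i : Fin m} {y : Torus N}
    (hv : IsStrictCompAt H B v i y) {s t : ℝ} (hs : 0 ≤ s) (ht : 0 < t) (hst : s + t = 1) :
    IsStrictCompAt H B (s • u + t • v) i y := by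
  obtain ⟨C, L, -, hL0, hbd⟩ := S.exists_bounds
  have hu' := (hbd u (hu.mono zero_le_one)).2
  obtain ⟨V, hV, hyV, δ, hδ, hae⟩ := hv
  refine ⟨V, hV, hyV, t * δ, by positivity, ?_⟩
  filter_upwards [S.ae_of_isSubsolution hL0 hu' hu i, hae] with z ⟨p, hp, hple⟩ hz hzV
  obtain ⟨q, hq, hqlt⟩ := hz hzV
  obtain ⟨h1, h2⟩ := S.lhs_convex_comb hs ht.le hst i hp hq
  exact ⟨_, h1, h2.trans_lt (by nlinarith)⟩

end Mollify

end WeaklyCoupled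

namespace WeaklyCoupled

open Filter Metric Set MeasureTheory

/-! ### Suprema of subsolutions, existence of critical subsolutions -/

section Sup

variable {N m : ℕ} {H : Fin m → Torus N → Eucl N → ℝ}
  {B : Torus N → Matrix (Fin m) (Fin m) ℝ}

lemma continuous_of_lift {u : Torus N → Fin m → ℝ} {L : ℝ} (hL0 : 0 ≤ L)
    (hL : ∀ i (z z' : Eucl N), u (proj z) i ≤ u (proj z') i + L * ‖z - z'‖) : Continuous u := by
  refine continuous_pi fun i => ?_
  have : LipschitzWith (L * N).toNNReal fun x => u x i := by
    refine LipschitzWith.of_dist_le_mul fun x y => ?_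
    rw [Real.coe_toNNReal _ (by positivity), Real.dist_eq]
    exact abs_sub_le_of_lift (v := fun x => u x i) hL0 (hL i) x y
  exact this.continuous

/-- Uniform bounds for subsolutions vanishing at a point. -/
lemma Admissible.exists_uniform_bounds (S : Admissible H B) : ∃ K L : ℝ, 0 ≤ K ∧ 0 ≤ L ∧
    ∀ u, IsSubsolution H B (fun _ => 1) u →
      (∀ i (z z' : Eucl N), u (proj z) i ≤ u (proj z') i + L * ‖z - z'‖) ∧
      (∀ i x x', |u x i - u x' i| ≤ L * N * dist x x') ∧
      ∀ x y i k, |u x i - u y k| ≤ K := by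
  obtain ⟨C, L, hC0, hL0, hbd⟩ := S.exists_bounds
  refine ⟨C + L * N, L, by positivity, hL0, fun u hu => ?_⟩
  obtain ⟨h1, h2⟩ := hbd u hu
  have h3 : ∀ i x x', |u x i - u x' i| ≤ L * N * dist x x' := fun i =>
    abs_sub_le_of_lift (v := fun x => u x i) hL0 (h2 i)
  refine ⟨h2, h3, fun x y i k => ?_⟩
  have e1 := abs_le.1 (h3 i x y)
  have e2 := h1 y i k
  have e3 := h1 y k i
  have e4 : L * N * dist x y ≤ L * N :=
    mul_le_of_le_one_right (by positivity) (dist_torus_le x y)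
  rw [abs_le]; constructor <;> linarith [e1.1, e1.2]

/-- The supremum of a family of subsolutions with values in a bounded interval is a
subsolution. -/
lemma Admissible.isSubsolution_iSup (S : Admissible H B) {ι : Type*} [Nonempty ι]
    {w : ι → Torus N → Fin m → ℝ} {a : ℝ} (ha : a ≤ 1)
    (hw : ∀ α, IsSubsolution H B (fun _ => a) (w α))
    (hbdd : ∀ x i, BddAbove (range fun α => w α x i)) :
    IsSubsolution H B (fun _ => a) fun x i => ⨆ α, w α x i := by
  obtain ⟨K, L, -, hL0, hbd⟩ := S.exists_uniform_bounds
  have hc : Continuous fun x i => ⨆ α, w α x i := by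
    refine continuous_of_lift hL0 fun i z z' => ?_
    refine ciSup_le fun α => ((hbd (w α) ((hw α).mono ha)).1 i z z').trans ?_
    exact add_le_add (le_ciSup (hbdd (proj z') i) α) le_rfl
  refine S.isSubsolution_of_approx hc fun x i η hη => ?_
  -- A member nearly attaining the supremum at this one `x` and `i` is enough, because the stability
  -- lemma is one-sided.
  obtain ⟨α, hα⟩ := exists_lt_of_lt_ciSup (sub_lt_self (⨆ α, w α x i) hη)
  refine ⟨w α, (hw α).mono (by linarith), fun y j => ?_, hα.le⟩
  exact (le_ciSup (hbdd y j) α).trans (by linarith)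

/-- The infimum defining the critical value is attained. For each level `e n` the supremum `U n` of
the subsolutions normalized by `u 0 k = 0` is again a subsolution; these suprema are uniformly
Lipschitz and decrease in `n`, so by Dini they converge uniformly to a subsolution at level 0. -/
lemma Admissible.exists_isSubsolution_zero (S : Admissible H B) (hc : IsCriticalValue H B 0)
    (k : Fin m) : ∃ u, IsSubsolution H B (fun _ => 0) u := by
  obtain ⟨K, L, hK0, hL0, hbd⟩ := S.exists_uniform_bounds
  set e : ℕ → ℝ := fun n => 1 / ((n : ℝ) + 1) with he
  have he0 : ∀ n, 0 < e n := fun n => by positivity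
  have he1 : ∀ n, e n ≤ 1 := fun n => by
    simp only [he]; rw [div_le_one (by positivity)]; linarith [(Nat.cast_nonneg n : (0 : ℝ) ≤ n)]
  have heanti : Antitone e := antitone_nat_of_succ_le fun n => by
    simp only [he]; push_cast
    exact one_div_le_one_div_of_le (by positivity) (by linarith)
  let ι : ℕ → Type := fun n =>
    {u : Torus N → Fin m → ℝ // IsSubsolution H B (fun _ => e n) u ∧ u 0 k = 0}
  have hne : ∀ n, Nonempty (ι n) := by
    intro n
    obtain ⟨a, ⟨u, hu⟩, -, ha⟩ := hc.exists_between (he0 n)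
    have hu' : IsSubsolution H B (fun _ => a) u := hu
    exact ⟨⟨_, S.isSubsolution_add_const (hu'.mono ha.le) (-u 0 k), by simp⟩⟩
  have hsub1 : ∀ n (α : ι n), IsSubsolution H B (fun _ => 1) α.1 := fun n α => α.2.1.mono (he1 n)
  have hK : ∀ n (α : ι n) x i, |α.1 x i| ≤ K := by
    intro n α x i
    have := (hbd _ (hsub1 n α)).2.2 x 0 i k
    rwa [α.2.2, sub_zero] at this
  have hbdd : ∀ n x i, BddAbove (range fun α : ι n => α.1 x i) := fun n x i =>
    ⟨K, by rintro _ ⟨α, rfl⟩; exact (abs_le.1 (hK n α x i)).2⟩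
  set U : ℕ → Torus N → Fin m → ℝ := fun n x i => ⨆ α : ι n, α.1 x i with hU
  have hUsub : ∀ n, IsSubsolution H B (fun _ => e n) (U n) := fun n =>
    S.isSubsolution_iSup (he1 n) (fun α : ι n => α.2.1) (hbdd n)
  have hUanti : ∀ x i, Antitone fun n => U n x i := by
    intro x i n n' hn
    exact ciSup_le fun α => le_ciSup (hbdd n x i) (⟨α.1, α.2.1.mono (heanti hn), α.2.2⟩ : ι n)
  have hUK : ∀ n x i, -K ≤ U n x i := by
    intro n x i
    obtain ⟨α⟩ := hne n
    exact (abs_le.1 (hK n α x i)).1.trans (le_ciSup (hbdd n x i) α)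
  have hbelow : ∀ x i, BddBelow (range fun n => U n x i) := fun x i =>
    ⟨-K, by rintro _ ⟨n, rfl⟩; exact hUK n x i⟩
  set V : Torus N → Fin m → ℝ := fun x i => ⨅ n, U n x i with hV
  have hVc : Continuous V := by
    refine continuous_of_lift hL0 fun i z z' => ?_
    rw [← sub_le_iff_le_add]
    refine le_ciInf fun n => ?_
    rw [sub_le_iff_le_add]
    exact (ciInf_le (hbelow _ i) n).trans ((hbd (U n) ((hUsub n).mono (he1 n))).1 i z z')
  refine ⟨V, S.isSubsolution_of_approx hVc fun x i η hη => ?_⟩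
  have hdini : ∀ j, TendstoUniformly (fun n y => U n y j) (fun y => V y j) atTop := fun j =>
    Antitone.tendstoUniformly_of_forall_tendsto
      (fun n => (continuous_apply j).comp (hUsub n).1) (fun n n' hn y => hUanti y j hn)
      ((continuous_apply j).comp hVc)
      fun y => tendsto_atTop_ciInf (hUanti y j) (hbelow y j)
  have hev : ∀ᶠ n in atTop, ∀ j y, dist (V y j) (U n y j) < η :=
    eventually_all.2 fun j => Metric.tendstoUniformly_iff.1 (hdini j) η hη
  have hev' : ∀ᶠ n in atTop, e n < η :=
    tendsto_one_div_add_atTop_nhds_zero_nat.eventually (gt_mem_nhds hη)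
  obtain ⟨n, hn, hn'⟩ := (hev.and hev').exists
  refine ⟨U n, (hUsub n).mono (by linarith), fun y j => ?_, ?_⟩
  · have := (abs_lt.1 (hn j y)).1
    linarith
  · have := ciInf_le (hbelow x i) n
    simp only [hV]
    linarith

/-! ### Supersolutions -/

lemma neg_mem_superdifferential {f : Eucl N → ℝ} {x p : Eucl N} (h : p ∈ subdifferential f x) :
    -p ∈ superdifferential (fun z => -f z) x := by
  obtain ⟨φ, h1, h2, h3⟩ := h
  refine ⟨fun z => -φ z, h1.neg, ?_, ?_⟩
  · filter_upwards [h2] with z hz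
    linarith
  · rw [hasGradientAt_iff_hasFDerivAt] at *
    rw [map_neg]; exact h3.neg

lemma neg_mem_subdifferential {f : Eucl N → ℝ} {x p : Eucl N}
    (h : p ∈ superdifferential (fun z => -f z) x) : -p ∈ subdifferential f x := by
  obtain ⟨φ, h1, h2, h3⟩ := h
  refine ⟨fun z => -φ z, h1.neg, ?_, ?_⟩
  · filter_upwards [h2] with z hz
    linarith
  · rw [hasGradientAt_iff_hasFDerivAt] at *
    rw [map_neg]; exact h3.neg

/-- Supersolutions are stable under uniform convergence. -/
lemma Admissible.isSupersolution_of_approx (S : Admissible H B) {u : Torus N → Fin m → ℝ}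
    (hu : Continuous u) {a : ℝ}
    (h : ∀ η > 0, ∃ v, IsSupersolution H B (fun _ => a) v ∧ ∀ y, ‖v y - u y‖ ≤ η) :
    IsSupersolution H B (fun _ => a) u := by
  refine ⟨hu, fun i x p hp => ?_⟩
  have hp' := frechetSuper_of_mem_superdifferential (neg_mem_superdifferential hp)
  have key : ∀ n : ℕ, ∃ (z q : Eucl N) (w : Fin m → ℝ), ‖z - x‖ ≤ 1 / ((n : ℝ) + 1) ∧
      ‖q - p‖ ≤ 6 * (1 / ((n : ℝ) + 1)) ∧ ‖w - u (proj z)‖ ≤ 1 / ((n : ℝ) + 1) ∧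
      a ≤ H i (proj z) q + (B (proj z)).mulVec w i := by
    intro n
    set e : ℝ := 1 / ((n : ℝ) + 1) with he
    have hepos : 0 < e := by positivity
    have he1 : e ≤ 1 := by
      rw [he, div_le_one (by positivity)]; linarith [(Nat.cast_nonneg n : (0 : ℝ) ≤ n)]
    obtain ⟨r0, hr0, hball⟩ := Metric.eventually_nhds_iff.1 (hp' (e / 2) (by positivity))
    set r : ℝ := min (r0 / 2) e
    have hr : 0 < r := by positivity
    have hre : r ≤ e := min_le_right _ _
    have her : 0 < e * r := by positivity
    have her1 : e * r ≤ e := by nlinarith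
    obtain ⟨v, hv, hvu⟩ := h (e * r / 2) (by positivity)
    have hvu' : ∀ y j, |v y j - u y j| ≤ e * r / 2 := fun y j =>
      (norm_le_pi_norm (v y - u y) j).trans (hvu y)
    -- The touching lemma is used on `-v`, so that a subgradient of `v` appears.
    obtain ⟨z, hz, q, hq, hqp, -⟩ := exists_superdifferential_near
      (g := fun z => -liftComp v i z) (x := x) (p := -p) (r := r) (e := e)
      (c := -u (proj x) i) hr hepos (continuous_liftComp hv.1 i).neg.continuousOn (fun z hz => by
        have hzx : ‖z - x‖ = r := by rwa [← dist_eq_norm]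
        have h1 := @hball z (by
          rw [dist_eq_norm, hzx]
          exact (min_le_left _ _).trans_lt (by linarith))
        have h2 := (abs_le.1 (hvu' (proj z) i)).1
        simp only [liftComp, hzx] at h1 ⊢
        linarith) (by
        have := (abs_le.1 (hvu' (proj x) i)).2
        simp only [liftComp]; linarith)
    refine ⟨z, -q, v (proj z), ?_, ?_, (hvu _).trans (by linarith),
      hv.2 i z (-q) (neg_mem_subdifferential hq)⟩
    · rw [← dist_eq_norm]; exact (mem_ball.1 hz).le.trans hre
    · have e1 : -q - p = -(q - -p) := by abel
      rw [e1, norm_neg]; exact hqp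
  choose z q w hz hq hw hmain using key
  have h0 : Tendsto (fun n : ℕ => 1 / ((n : ℝ) + 1)) atTop (𝓝 0) :=
    tendsto_one_div_add_atTop_nhds_zero_nat
  have tz : Tendsto z atTop (𝓝 x) := by
    rw [tendsto_iff_norm_sub_tendsto_zero]
    exact squeeze_zero (fun _ => norm_nonneg _) hz h0
  have tq : Tendsto q atTop (𝓝 p) := by
    rw [tendsto_iff_norm_sub_tendsto_zero]
    exact squeeze_zero (fun _ => norm_nonneg _) hq (by simpa using h0.const_mul 6)
  have tpz : Tendsto (fun n => proj (z n)) atTop (𝓝 (proj x)) :=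
    (continuous_proj.tendsto x).comp tz
  have tw : Tendsto w atTop (𝓝 (u (proj x))) := by
    have h1 : Tendsto (fun n => w n - u (proj (z n))) atTop (𝓝 0) :=
      squeeze_zero_norm hw h0
    have h2 := h1.add ((hu.tendsto (proj x)).comp tpz)
    simpa using h2
  have hBc : Continuous fun z : Torus N × (Fin m → ℝ) => (B z.1).mulVec z.2 i :=
    (continuous_apply i).comp ((S.cont.comp continuous_fst).matrix_mulVec continuous_snd)
  have t1 : Tendsto (fun n => H i (proj (z n)) (q n)) atTop (𝓝 (H i (proj x) p)) :=
    ((S.continuous_ham i).tendsto (proj x, p)).comp (tpz.prodMk_nhds tq)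
  have t2 := (hBc.tendsto (proj x, u (proj x))).comp (tpz.prodMk_nhds tw)
  exact ge_of_tendsto' (t1.add t2) hmain

/-! ### The Mañé matrix and the Aubry set -/

lemma mem_criticalSubsolutions {v : C(Torus N, Fin m → ℝ)} :
    v ∈ criticalSubsolutions H B ↔ IsSubsolution H B (fun _ => 0) v := Iff.rfl

lemma Admissible.bddAbove_mane (S : Admissible H B) (i k : Fin m) (y x : Torus N) :
    BddAbove (range fun v : criticalSubsolutions H B => v.1 x i - v.1 y k) := by
  obtain ⟨K, L, hK0, hL0, hbd⟩ := S.exists_uniform_bounds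
  refine ⟨K, ?_⟩
  rintro _ ⟨v, rfl⟩
  exact (abs_le.1 ((hbd v.1 (IsSubsolution.mono v.2 zero_le_one)).2.2 x y i k)).2

lemma Admissible.nonempty_criticalSubsolutions (S : Admissible H B) (hc : IsCriticalValue H B 0)
    (k : Fin m) : Nonempty (criticalSubsolutions H B) := by
  obtain ⟨u, hu⟩ := S.exists_isSubsolution_zero hc k
  exact ⟨⟨⟨u, hu.1⟩, hu⟩⟩

lemma Admissible.isSubsolution_mane (S : Admissible H B) (hc : IsCriticalValue H B 0)
    (k : Fin m) (y : Torus N) : IsSubsolution H B (fun _ => 0) fun x i => mane H B i k y x := by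
  have := S.nonempty_criticalSubsolutions hc k
  refine S.isSubsolution_iSup (w := fun (v : criticalSubsolutions H B) x i => v.1 x i - v.1 y k)
    zero_le_one (fun v => ?_) fun x i => S.bddAbove_mane i k y x
  simp only [sub_eq_add_neg]
  exact S.isSubsolution_add_const v.2 _

lemma Admissible.le_mane (S : Admissible H B) {v : Torus N → Fin m → ℝ}
    (hv : IsSubsolution H B (fun _ => 0) v) (i k : Fin m) (y x : Torus N) :
    v x i - v y k ≤ mane H B i k y x :=
  le_ciSup (S.bddAbove_mane i k y x) ⟨⟨v, hv.1⟩, hv⟩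

lemma mane_self (hne : Nonempty (criticalSubsolutions H B)) (k : Fin m) (y : Torus N) :
    mane H B k k y y = 0 := by
  simp [mane]

/-- The Mañé columns depend on `y` in a Lipschitz way, uniformly in `x`, and supersolutions are
stable under uniform limits. Closedness makes the complement an open set, on which smoothing makes
sense. -/
lemma Admissible.isClosed_aubrySet (S : Admissible H B) (hc : IsCriticalValue H B 0)
    (k : Fin m) : IsClosed (aubrySet H B k) := by
  have := S.nonempty_criticalSubsolutions hc k
  obtain ⟨K, L, hK0, hL0, hbd⟩ := S.exists_uniform_bounds
  have hle : ∀ i y y' x, mane H B i k y x ≤ mane H B i k y' x + L * N * dist y y' := by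
    intro i y y' x
    refine ciSup_le fun v => ?_
    have h1 := le_ciSup (S.bddAbove_mane i k y' x) v
    have h2 := (abs_le.1 ((hbd v.1 (IsSubsolution.mono v.2 zero_le_one)).2.1 k y y')).1
    simp only [mane]
    linarith
  refine isClosed_of_closure_subset fun y hy => ⟨S.isSubsolution_mane hc k y, ?_⟩
  refine S.isSupersolution_of_approx (S.isSubsolution_mane hc k y).1 fun η hη => ?_
  obtain ⟨y', hy', hd⟩ := Metric.mem_closure_iff.1 hy (η / (L * N + 1)) (by positivity)
  refine ⟨_, hy'.2, fun x => (pi_norm_le_iff_of_nonneg hη.le).2 fun i => ?_⟩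
  have h1 := hle i y y' x
  have h2 := hle i y' y x
  rw [dist_comm] at h2
  have h3 : L * N * dist y y' ≤ η := by
    rw [lt_div_iff₀ (by positivity)] at hd
    nlinarith [dist_nonneg (x := y) (y := y')]
  rw [Pi.sub_apply, Real.norm_eq_abs, abs_le]
  constructor <;> linarith

end Sup

end WeaklyCoupled

namespace WeaklyCoupled

open Filter Metric Set MeasureTheory

/-! ### Smooth functions on the torus -/

section Smooth

variable {N : ℕ}

lemma continuous_toCircle_coord (l : Fin N) :
    Continuous fun x : Torus N => (AddCircle.toCircle (x l) : ℂ) :=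
  continuous_subtype_val.comp (AddCircle.continuous_toCircle.comp (continuous_apply l))

lemma toCircle_proj (z : Eucl N) (l : Fin N) :
    (AddCircle.toCircle (proj z l) : ℂ) = Complex.exp ((2 * Real.pi * z l : ℝ) * Complex.I) := by
  rw [proj, AddCircle.toCircle_apply_mk, Circle.coe_exp, div_one]

/-- Every open subset of the torus is the support of a smooth function with values in `[0, 1]`. -/
lemma exists_smooth_support_eq {V : Set (Torus N)} (hV : IsOpen V) :
    ∃ θ : Torus N → ℝ, Continuous θ ∧ ContDiff ℝ ∞ (fun z => θ (proj z)) ∧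
      (∀ x, 0 ≤ θ x) ∧ (∀ x, θ x ≤ 1) ∧ ∀ x, θ x ≠ 0 ↔ x ∈ V := by
  -- The torus embeds in `ℂ^N` by a map with smooth lift, so the function can be pulled back from an
  -- open set of a vector space.
  set e : Torus N → (Fin N → ℂ) := fun x l => (AddCircle.toCircle (x l) : ℂ) with he
  have hec : Continuous e := continuous_pi continuous_toCircle_coord
  have hei : Function.Injective e := by
    intro x y hxy
    funext l
    exact AddCircle.injective_toCircle one_ne_zero (Subtype.ext (congrFun hxy l))
  have hcl : IsClosed (e '' Vᶜ) := (hV.isClosed_compl.isCompact.image hec).isClosed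
  obtain ⟨f, hsupp, hf, hrange⟩ := hcl.isOpen_compl.exists_contDiff_support_eq (n := ⊤)
  refine ⟨fun x => f (e x), hf.continuous.comp hec, hf.comp ?_, fun x => (hrange ⟨_, rfl⟩).1,
    fun x => (hrange ⟨_, rfl⟩).2, fun x => ?_⟩
  · refine contDiff_pi.2 fun l => ?_
    simp only [he, toCircle_proj]
    have h1 : ContDiff ℝ ∞ fun z : Eucl N => 2 * Real.pi * z l :=
      contDiff_const.mul (EuclideanSpace.proj l : Eucl N →L[ℝ] ℝ).contDiff
    exact ((Complex.ofRealCLM.contDiff.comp h1).mul contDiff_const).cexp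
  · have h1 : f (e x) ≠ 0 ↔ e x ∈ (e '' Vᶜ)ᶜ := by rw [← hsupp]; rfl
    rw [h1, mem_compl_iff, hei.mem_set_image, mem_compl_iff, not_not]

lemma hasGradientAt_of_proj_eq {θ : Torus N → ℝ} {z z' g : Eucl N} (h : proj z = proj z')
    (hg : HasGradientAt (fun z => θ (proj z)) g z) : HasGradientAt (fun z => θ (proj z)) g z' := by
  rw [hasGradientAt_iff_hasFDerivAt] at *
  have h1 : (fun w : Eucl N => θ (proj w)) = fun w => (fun z => θ (proj z)) (w + (z - z')) := by
    funext w
    simp only [proj_add, proj_sub, h, sub_self, add_zero]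
  rw [h1]
  have h2 : HasFDerivAt (fun z => θ (proj z)) (InnerProductSpace.toDual ℝ (Eucl N) g)
      (z' + (z - z')) := by rwa [add_sub_cancel]
  exact h2.comp z' ((hasFDerivAt_id z').add_const (z - z'))

/-- The gradient is periodic, and every point of the torus has a lift in the compact ball of radius
`N`. -/
lemma exists_gradient_bound {θ : Torus N → ℝ} (h : ContDiff ℝ ∞ fun z => θ (proj z)) :
    ∃ K, 0 ≤ K ∧ ∀ z g, HasGradientAt (fun z => θ (proj z)) g z → ‖g‖ ≤ K := by
  have hc : Continuous fun z => fderiv ℝ (fun z => θ (proj z)) z := h.continuous_fderiv (by simp)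
  obtain ⟨K, hK⟩ := (isCompact_closedBall (0 : Eucl N) N).exists_bound_of_continuousOn
    hc.continuousOn
  refine ⟨|K|, abs_nonneg _, fun z g hg => ?_⟩
  obtain ⟨z', hz', -, hn⟩ := exists_lift_near (proj z) 0
  have hg' := hasGradientAt_of_proj_eq hz'.symm hg
  have h1 := hK z' (by
    rw [mem_closedBall_zero_iff]
    rw [sub_zero] at hn
    exact hn.trans (mul_le_of_le_one_right (Nat.cast_nonneg _) (dist_torus_le _ _)))
  rw [hg'.hasFDerivAt.fderiv, LinearIsometryEquiv.norm_map] at h1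
  exact h1.trans (le_abs_self _)

/-- A periodic substitute for the squared distance to a point. -/
lemma exists_periodic_sq_dist (x₀ : Eucl N) : ∃ D : Torus N → ℝ, Continuous D ∧ D (proj x₀) = 0 ∧
    (∀ z, ∃ g, HasGradientAt (fun z => D (proj z)) g z ∧ ‖g‖ ≤ 40 * ‖z - x₀‖) ∧
    ∀ z : Eucl N, (∀ l, |z l - x₀ l| ≤ 1 / 2) → 8 * ‖z - x₀‖ ^ 2 ≤ D (proj z) := by
  -- This is the sum of `1 - cos (2π (z l - x₀ l))`. The constant 8 comes from `cos t ≤ 1 - 2 t² /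
  -- π²` for `|t| ≤ π`, and 40 bounds `4π²`.
  set D : Torus N → ℝ := fun x => ∑ l, (1 - (AddCircle.toCircle ((x - proj x₀) l) : ℂ).re)
  have hD : ∀ z, D (proj z) = ∑ l, (1 - Real.cos (2 * Real.pi * (z l - x₀ l))) := by
    intro z
    refine Finset.sum_congr rfl fun l _ => ?_
    rw [← proj_sub, toCircle_proj, Complex.exp_ofReal_mul_I_re]
    simp
  refine ⟨D, ?_, ?_, fun z => ?_, fun z hz => ?_⟩
  · refine continuous_finsetSum _ fun l _ => continuous_const.sub (Complex.continuous_re.comp ?_)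
    exact (continuous_toCircle_coord l).comp (continuous_id.sub continuous_const)
  · rw [hD]; simp
  · refine ⟨WithLp.toLp 2 fun l => 2 * Real.pi * Real.sin (2 * Real.pi * (z l - x₀ l)), ?_, ?_⟩
    · simp only [hD]
      rw [hasGradientAt_iff_hasFDerivAt]
      have h1 : ∀ l, HasFDerivAt (fun z : Eucl N => 1 - Real.cos (2 * Real.pi * (z l - x₀ l)))
          ((2 * Real.pi * Real.sin (2 * Real.pi * (z l - x₀ l))) •
            (EuclideanSpace.proj l : Eucl N →L[ℝ] ℝ)) z := by
        intro l
        have h2 : HasFDerivAt (fun z : Eucl N => z l) (EuclideanSpace.proj l : Eucl N →L[ℝ] ℝ) z :=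
          (EuclideanSpace.proj l : Eucl N →L[ℝ] ℝ).hasFDerivAt
        have h3 := (((h2.sub_const (x₀ l)).const_mul (2 * Real.pi)).cos).const_sub 1
        refine h3.congr_fderiv ?_
        ext w
        simp only [neg_apply, smul_apply, smul_eq_mul]
        ring
      refine (HasFDerivAt.fun_sum fun l _ => h1 l).congr_fderiv ?_
      ext w
      simp only [InnerProductSpace.toDual_apply_apply, PiLp.inner_apply,
        sum_apply, smul_apply, smul_eq_mul]
      refine Finset.sum_congr rfl fun l _ => ?_
      simp [mul_comm]
    · rw [EuclideanSpace.norm_eq, EuclideanSpace.norm_eq, ← Real.sqrt_sq (by norm_num : (0:ℝ) ≤ 40),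
        ← Real.sqrt_mul (by positivity), Finset.mul_sum]
      refine Real.sqrt_le_sqrt (Finset.sum_le_sum fun l _ => ?_)
      simp only [PiLp.sub_apply]
      rw [← mul_pow]
      refine pow_le_pow_left₀ (norm_nonneg _) ?_ 2
      rw [norm_mul, Real.norm_of_nonneg (by positivity : (0:ℝ) ≤ 2 * Real.pi), Real.norm_eq_abs,
        Real.norm_eq_abs]
      have h4 : |Real.sin (2 * Real.pi * (z l - x₀ l))| ≤ 2 * Real.pi * |z l - x₀ l| := by
        refine Real.abs_sin_le_abs.trans ?_
        rw [abs_mul, abs_of_nonneg (by positivity : (0:ℝ) ≤ 2 * Real.pi)]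
      have h5 := Real.pi_lt_d2
      have h6 := Real.pi_pos
      have h7 : (2 * Real.pi) * (2 * Real.pi) ≤ 40 := by nlinarith
      calc 2 * Real.pi * |Real.sin (2 * Real.pi * (z l - x₀ l))|
          ≤ 2 * Real.pi * (2 * Real.pi * |z l - x₀ l|) := by gcongr
        _ = (2 * Real.pi) * (2 * Real.pi) * |z l - x₀ l| := by ring
        _ ≤ 40 * |z l - x₀ l| := by gcongr
  · rw [hD, EuclideanSpace.norm_eq, Real.sq_sqrt (Finset.sum_nonneg fun _ _ => by positivity),
      Finset.mul_sum]
    refine Finset.sum_le_sum fun l _ => ?_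
    simp only [PiLp.sub_apply, Real.norm_eq_abs, sq_abs]
    have h1 : |2 * Real.pi * (z l - x₀ l)| ≤ Real.pi := by
      rw [abs_mul, abs_of_nonneg (by positivity : (0:ℝ) ≤ 2 * Real.pi)]
      nlinarith [hz l, Real.pi_pos]
    have h2 := Real.cos_le_one_sub_mul_cos_sq h1
    have h3 : 2 / Real.pi ^ 2 * (2 * Real.pi * (z l - x₀ l)) ^ 2 = 8 * (z l - x₀ l) ^ 2 := by
      have := Real.pi_pos.ne'
      field_simp; ring
    linarith

/-- There are smooth periodic functions with a prescribed gradient at a point. -/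
lemma exists_periodic_linear (x₀ p : Eucl N) : ∃ P : Torus N → ℝ, Continuous P ∧
    ContDiff ℝ ∞ (fun z => P (proj z)) ∧ HasGradientAt (fun z => P (proj z)) p x₀ := by
  set P : Torus N → ℝ := fun x => ∑ l, p l / (2 * Real.pi) *
    (AddCircle.toCircle ((x - proj x₀) l) : ℂ).im
  have hP : ∀ z, P (proj z) = ∑ l, p l / (2 * Real.pi) *
      Real.sin (2 * Real.pi * (z l - x₀ l)) := by
    intro z
    refine Finset.sum_congr rfl fun l _ => ?_
    rw [← proj_sub, toCircle_proj, Complex.exp_ofReal_mul_I_im]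
    simp
  refine ⟨P, ?_, ?_, ?_⟩
  · refine continuous_finsetSum _ fun l _ => continuous_const.mul (Complex.continuous_im.comp ?_)
    exact (continuous_toCircle_coord l).comp (continuous_id.sub continuous_const)
  · simp only [hP]
    refine ContDiff.sum fun l _ => contDiff_const.mul (ContDiff.sin (contDiff_const.mul ?_))
    exact (EuclideanSpace.proj l : Eucl N →L[ℝ] ℝ).contDiff.sub contDiff_const
  · simp only [hP]
    rw [hasGradientAt_iff_hasFDerivAt]
    have h1 : ∀ l, HasFDerivAt (fun z : Eucl N => p l / (2 * Real.pi) *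
        Real.sin (2 * Real.pi * (z l - x₀ l)))
        (p l • (EuclideanSpace.proj l : Eucl N →L[ℝ] ℝ)) x₀ := by
      intro l
      have h2 : HasFDerivAt (fun z : Eucl N => z l) (EuclideanSpace.proj l : Eucl N →L[ℝ] ℝ) x₀ :=
        (EuclideanSpace.proj l : Eucl N →L[ℝ] ℝ).hasFDerivAt
      have h3 := (((h2.sub_const (x₀ l)).const_mul (2 * Real.pi)).sin).const_mul
        (p l / (2 * Real.pi))
      refine h3.congr_fderiv ?_
      ext w
      have := Real.pi_pos.ne'
      simp only [smul_apply, smul_eq_mul, sub_self, mul_zero, Real.cos_zero, one_mul]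
      field_simp
    refine (HasFDerivAt.fun_sum fun l _ => h1 l).congr_fderiv ?_
    ext w
    simp only [InnerProductSpace.toDual_apply_apply, PiLp.inner_apply,
      sum_apply, smul_apply, smul_eq_mul]
    refine Finset.sum_congr rfl fun l _ => ?_
    simp [mul_comm]

/-- A Fréchet subgradient of a periodic function is realized, up to a small error, by a periodic
function that crosses it from above only near the given point. -/
lemma exists_periodic_test_function {u : Torus N → ℝ} (hu : Continuous u) {x₀ p : Eucl N}
    (hp : FrechetSuper (fun z => -u (proj z)) x₀ (-p)) {e : ℝ} (he : 0 < e) :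
    ∃ ψ : Torus N → ℝ, Continuous ψ ∧ u (proj x₀) < ψ (proj x₀) ∧
      ∀ y, u y ≤ ψ y → ∃ z, proj z = y ∧ ‖z - x₀‖ ≤ e ∧ ψ y - u y ≤ e ∧
        ∃ g, HasGradientAt (fun z => ψ (proj z)) g z ∧ ‖g - p‖ ≤ e := by
  obtain ⟨D, hDc, hD0, hDg, hDle⟩ := exists_periodic_sq_dist x₀
  obtain ⟨P, hPc, hPs, hPg⟩ := exists_periodic_linear x₀ p
  set ε := min (e / 50) 1 with hε
  have hε0 : 0 < ε := by positivity
  have hεe : 50 * ε ≤ e := by linarith [min_le_left (e / 50) 1]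
  have hPdiff : Differentiable ℝ fun z => P (proj z) := hPs.differentiable (by simp)
  have hgradc : Continuous fun z => gradient (fun z => P (proj z)) z :=
    (LinearIsometryEquiv.continuous _).comp (hPs.continuous_fderiv (by simp))
  have hev1 : ∀ᶠ z in 𝓝 x₀, ‖gradient (fun z => P (proj z)) z - p‖ < ε := by
    have h1 := (hgradc.tendsto x₀).eventually (Metric.ball_mem_nhds _ hε0)
    filter_upwards [h1] with z hz
    rw [hPg.gradient] at hz
    rwa [← dist_eq_norm]
  have hev2 : ∀ᶠ z in 𝓝 x₀, u (proj x₀) - P (proj x₀) - ε * ‖z - x₀‖ ≤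
      u (proj z) - P (proj z) := by
    filter_upwards [hp (ε / 2) (by positivity), hPg.eventually_abs_le (half_pos hε0)] with z h1 h2
    have h3 := (abs_le.1 h2).2
    rw [inner_neg_left] at h1
    linarith
  obtain ⟨r', hr', hball⟩ := Metric.eventually_nhds_iff.1 (hev1.and hev2)
  set r := min r' (min 1 e)
  have hr : 0 < r := by positivity
  have hr1 : r ≤ 1 := (min_le_right _ _).trans (min_le_left _ _)
  have hre : r ≤ e := (min_le_right _ _).trans (min_le_right _ _)
  obtain ⟨M, hM0, hM⟩ := exists_abs_le_of_continuous (hu.sub hPc)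
  -- At distance at least `r` the penalty `C * D` is at least `2 * M + 2`, which puts `ψ` strictly
  -- below `u`.
  set C : ℝ := (2 * M + 2) / (8 * r ^ 2) with hC
  have hC0 : 0 < C := by positivity
  have hCr : 8 * C * r ^ 2 = 2 * M + 2 := by rw [hC]; field_simp
  -- Where `u ≤ ψ` one has `8 C t² ≤ ε t + τ`, with `t` the distance to `x₀`; then `C τ ≤ ε²` forces
  -- `C t ≤ ε`, so the penalty has gradient at most `40 ε`.
  set τ := min ε (ε ^ 2 / C)
  have hτ0 : 0 < τ := by positivity
  have hτε : τ ≤ ε := min_le_left _ _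
  have hCτ : C * τ ≤ ε ^ 2 := by
    rw [mul_comm, ← le_div_iff₀ hC0]; exact min_le_right _ _
  refine ⟨fun y => P y + (u (proj x₀) - P (proj x₀) + τ - C * D y), by fun_prop, ?_,
    fun y hy => ?_⟩
  · simp only [hD0]; linarith
  obtain ⟨z, rfl, hz, -⟩ := exists_lift_near y x₀
  have h8 := hDle z hz
  simp only [Pi.sub_apply] at hM hy
  have hM1 := abs_le.1 (hM (proj x₀))
  have hM2 := abs_le.1 (hM (proj z))
  have hτ1 : τ ≤ 1 := hτε.trans (min_le_right _ _)
  have hCD := mul_le_mul_of_nonneg_left h8 hC0.le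
  have ht : ‖z - x₀‖ < r := by
    refine lt_of_pow_lt_pow_left₀ 2 hr.le ?_
    have : 8 * C * ‖z - x₀‖ ^ 2 < 8 * C * r ^ 2 := by
      rw [hCr]; linarith [hM1.1, hM1.2, hM2.1, hM2.2]
    exact lt_of_mul_lt_mul_left this (by positivity)
  obtain ⟨h1, h2⟩ := @hball z (by rw [dist_eq_norm]; exact ht.trans_le (min_le_left _ _))
  set t := ‖z - x₀‖
  have ht0 : 0 ≤ t := norm_nonneg _
  have hX : C * t ≤ ε := by
    by_contra! hlt
    have h3 : C * (8 * t ^ 2) ≤ ε * t + τ := by linarith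
    have h4 : C * (C * (8 * t ^ 2)) ≤ C * (ε * t + τ) := mul_le_mul_of_nonneg_left h3 hC0.le
    nlinarith
  have hεt : ε * t ≤ ε := mul_le_of_le_one_right hε0.le (ht.le.trans hr1)
  have hDnn : 0 ≤ C * D (proj z) := le_trans (by positivity) hCD
  obtain ⟨g, hg, hgn⟩ := hDg z
  refine ⟨z, rfl, ht.le.trans hre, by linarith, gradient (fun z => P (proj z)) z - C • g, ?_, ?_⟩
  · have h3 := (hPdiff z).hasGradientAt
    rw [hasGradientAt_iff_hasFDerivAt] at *
    rw [map_sub, map_smul, sub_eq_add_neg]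
    exact h3.add (((hg.const_mul C).const_sub _))
  · have h4 : ‖C • g‖ ≤ 40 * ε := by
      rw [norm_smul, Real.norm_of_nonneg hC0.le]
      have := mul_le_mul_of_nonneg_left hgn hC0.le
      linarith
    have h5 : gradient (fun z => P (proj z)) z - C • g - p =
        (gradient (fun z => P (proj z)) z - p) - C • g := by abel
    rw [h5]
    refine (norm_sub_le _ _).trans ?_
    linarith

end Smooth

end WeaklyCoupled

namespace WeaklyCoupled

open Filter Metric Set MeasureTheory

/-! ### Strict subsolutions outside the Aubry set -/

section Strict

variable {N m : ℕ} {H : Fin m → Torus N → Eucl N → ℝ}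
  {B : Torus N → Matrix (Fin m) (Fin m) ℝ}

lemma mulVec_update (M : Matrix (Fin m) (Fin m) ℝ) (u : Fin m → ℝ) (i : Fin m) (c : ℝ)
    (j : Fin m) : M.mulVec (Function.update u i c) j = M.mulVec u j + M j i * (c - u i) := by
  have h1 : Function.update u i c = u + Pi.single i (c - u i) := by
    funext l
    by_cases hl : l = i
    · subst hl; simp
    · simp [hl]
  rw [h1, Matrix.mulVec_add, Pi.add_apply, Matrix.mulVec_single]
  simp

/-- The function `v` with its `i`-th component replaced by `f`. -/
def replaceComp (v : Torus N → Fin m → ℝ) (i : Fin m) (f : Torus N → ℝ) :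
    Torus N → Fin m → ℝ := fun x => Function.update (v x) i (f x)

lemma liftComp_replaceComp_self (v : Torus N → Fin m → ℝ) (i : Fin m) (f : Torus N → ℝ) :
    liftComp (replaceComp v i f) i = fun z => f (proj z) := by
  funext z; simp [liftComp, replaceComp]

lemma liftComp_replaceComp_of_ne (v : Torus N → Fin m → ℝ) {i j : Fin m} (hj : j ≠ i)
    (f : Torus N → ℝ) : liftComp (replaceComp v i f) j = liftComp v j := by
  funext z; simp [liftComp, replaceComp, hj]

lemma continuous_replaceComp {v : Torus N → Fin m → ℝ} (hv : Continuous v) (i : Fin m)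
    {f : Torus N → ℝ} (hf : Continuous f) : Continuous (replaceComp v i f) :=
  hv.update i hf

lemma lhs_replaceComp (v : Torus N → Fin m → ℝ) (i : Fin m) (f : Torus N → ℝ) (j : Fin m)
    (x : Torus N) (p : Eucl N) : lhs H B (replaceComp v i f) j x p =
      lhs H B v j x p + B x j i * (f x - v x i) := by
  simp only [lhs, replaceComp, mulVec_update]; ring

/-- Increasing one component preserves the subsolution inequalities of the other ones. -/
lemma Admissible.lhs_replaceComp_le (S : Admissible H B) (v : Torus N → Fin m → ℝ) {i j : Fin m}
    (hj : j ≠ i) {f : Torus N → ℝ} {x : Torus N} (hf : v x i ≤ f x) (p : Eucl N) :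
    lhs H B (replaceComp v i f) j x p ≤ lhs H B v j x p := by
  rw [lhs_replaceComp]
  have := mul_nonpos_of_nonpos_of_nonneg ((S.coupling x).1 j i hj.symm) (sub_nonneg.2 hf)
  linarith

/-- Replacing a component by its maximum with a suitable smooth function gives a subsolution. -/
lemma Admissible.isSubsolution_replaceComp_max (S : Admissible H B) {u : Torus N → Fin m → ℝ}
    (hu : IsSubsolution H B (fun _ => 0) u) (i : Fin m) {ψ : Torus N → ℝ} (hψ : Continuous ψ)
    {δ : ℝ} (hδ : 0 ≤ δ)
    (h : ∀ z, u (proj z) i ≤ ψ (proj z) → ∃ g, HasGradientAt (fun z => ψ (proj z)) g z ∧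
      lhs H B u i (proj z) g + B (proj z) i i * (ψ (proj z) - u (proj z) i) ≤ -δ) :
    IsSubsolution H B (fun _ => 0) (replaceComp u i fun x => max (u x i) (ψ x)) ∧
      ∀ z p, u (proj z) i ≤ ψ (proj z) →
        FrechetSuper (liftComp (replaceComp u i fun x => max (u x i) (ψ x)) i) z p →
        lhs H B (replaceComp u i fun x => max (u x i) (ψ x)) i (proj z) p ≤ -δ := by
  have hstrict : ∀ z p, u (proj z) i ≤ ψ (proj z) →
        FrechetSuper (liftComp (replaceComp u i fun x => max (u x i) (ψ x)) i) z p →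
        lhs H B (replaceComp u i fun x => max (u x i) (ψ x)) i (proj z) p ≤ -δ := by
    intro z p hz hp
    obtain ⟨g, hg, hle⟩ := h z hz
    rw [liftComp_replaceComp_self] at hp
    -- Here `ψ` touches the maximum from below, so its gradient is the only possible supergradient.
    have hpg := hp.sub_eq_of_le hg (.of_forall fun y => le_max_right _ _) (max_eq_right hz).symm
    rw [hpg, lhs_replaceComp, max_eq_right hz]
    exact hle
  refine ⟨S.isSubsolution_iff.2 ⟨continuous_replaceComp hu.1 i
    (((continuous_apply i).comp hu.1).max hψ), fun j x p hp => ?_⟩, hstrict⟩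
  have hu' := (S.isSubsolution_iff.1 hu).2
  by_cases hj : j = i
  · subst hj
    rcases le_or_gt (u (proj x) j) (ψ (proj x)) with hle | hlt
    · exact (hstrict x p hle hp).trans (by linarith)
    · rw [liftComp_replaceComp_self] at hp
      have hp' : FrechetSuper (liftComp u j) x p :=
        hp.of_le (.of_forall fun y => le_max_left _ _) (max_eq_left hlt.le).symm
      rw [lhs_replaceComp, max_eq_left hlt.le, sub_self, mul_zero, add_zero]
      exact hu' j x p hp'
  · rw [liftComp_replaceComp_of_ne _ hj] at hp
    exact (S.lhs_replaceComp_le u hj (le_max_left _ _) p).trans (hu' j x p hp)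

/-- Strictness in the viscosity sense of a component at a point. -/
def ViscStrictAt (H : Fin m → Torus N → Eucl N → ℝ) (B : Torus N → Matrix (Fin m) (Fin m) ℝ)
    (v : Torus N → Fin m → ℝ) (i : Fin m) (y : Torus N) : Prop :=
  ∃ V : Set (Torus N), IsOpen V ∧ y ∈ V ∧ ∃ δ : ℝ, 0 < δ ∧ ∀ z p, proj z ∈ V →
    FrechetSuper (liftComp v i) z p → lhs H B v i (proj z) p ≤ -δ

lemma Admissible.isStrictCompAt_of_viscStrictAt (S : Admissible H B) {v : Torus N → Fin m → ℝ}
    (hv : IsSubsolution H B (fun _ => 0) v) {i : Fin m} {y : Torus N}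
    (h : ViscStrictAt H B v i y) : IsStrictCompAt H B v i y := by
  obtain ⟨C, L, -, hL0, hbd⟩ := S.exists_bounds
  have hv' := (hbd v (hv.mono zero_le_one)).2
  obtain ⟨V, hV, hyV, δ, hδ, hle⟩ := h
  refine ⟨V, hV, hyV, δ / 2, by positivity, ?_⟩
  filter_upwards [ae_hasGradientAt_of_lipschitz hL0 (hv' i)] with z ⟨p, hp, _⟩ hz
  have := hle z p hz hp.frechetSuper
  exact ⟨p, hp, by linarith⟩

/-- Outside the Aubry set there is a critical subsolution one component of which is strict. -/
lemma Admissible.exists_viscStrictAt_of_notMem (S : Admissible H B) (hc : IsCriticalValue H B 0)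
    {k : Fin m} {y : Torus N} (hy : y ∉ aubrySet H B k) :
    ∃ w, IsSubsolution H B (fun _ => 0) w ∧ ViscStrictAt H B w k y := by
  set u : Torus N → Fin m → ℝ := fun x i => mane H B i k y x with hu
  have husub : IsSubsolution H B (fun _ => 0) u := S.isSubsolution_mane hc k y
  have huy : u y k = 0 := mane_self (S.nonempty_criticalSubsolutions hc k) k y
  have hns : ¬ IsSupersolution H B (fun _ => 0) u := fun h => hy ⟨husub, h⟩
  have : ∃ i x, ∃ p ∈ subdifferential (liftComp u i) x, lhs H B u i (proj x) p < 0 := by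
    by_contra! hcon
    exact hns ⟨husub.1, fun i x p hp => hcon i x p hp⟩
  obtain ⟨i, x, p, hp, hlt⟩ := this
  have hp' := frechetSuper_of_mem_superdifferential (neg_mem_superdifferential hp)
  set δ : ℝ := -lhs H B u i (proj x) p / 2 with hδ
  have hδ0 : 0 < δ := by rw [hδ]; linarith
  -- The third variable is the height by which component `i` is raised; continuity of `Q` tells how
  -- close the test function must be to keep the strict inequality.
  set Q : Eucl N × Eucl N × ℝ → ℝ := fun w =>
    lhs H B u i (proj w.1) w.2.1 + B (proj w.1) i i * w.2.2 with hQ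
  have hQc : Continuous Q := by
    have h1 : Continuous fun w : Eucl N × Eucl N × ℝ => H i (proj w.1) w.2.1 :=
      (S.continuous_ham i).comp ((continuous_proj.comp continuous_fst).prodMk
        (continuous_fst.comp continuous_snd))
    have h2 : Continuous fun w : Eucl N × Eucl N × ℝ => (B (proj w.1)).mulVec (u (proj w.1)) i :=
      (S.continuous_mulVec husub.1 i).comp (continuous_proj.comp continuous_fst)
    have h3 : Continuous fun w : Eucl N × Eucl N × ℝ => B (proj w.1) i i :=
      (S.continuous_entry i i).comp (continuous_proj.comp continuous_fst)
    exact (h1.add h2).add (h3.mul (continuous_snd.comp continuous_snd))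
  have hQ0 : Q (x, p, 0) < -δ := by
    simp only [hQ, mul_zero, add_zero, hδ]; linarith
  obtain ⟨e', he', hball⟩ := Metric.eventually_nhds_iff.1
    ((hQc.tendsto (x, p, 0)).eventually (gt_mem_nhds hQ0))
  obtain ⟨ψ, hψ, hψx, hψle⟩ := exists_periodic_test_function
    ((continuous_apply i).comp husub.1) hp' (half_pos he')
  have hmain : ∀ z, u (proj z) i ≤ ψ (proj z) →
      ∃ g, HasGradientAt (fun z => ψ (proj z)) g z ∧
        lhs H B u i (proj z) g + B (proj z) i i * (ψ (proj z) - u (proj z) i) ≤ -δ := by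
    intro z hz
    obtain ⟨z', hzz, hz', hs, g, hg, hgp⟩ := hψle (proj z) hz
    refine ⟨g, hasGradientAt_of_proj_eq hzz hg, ?_⟩
    have := @hball (z', g, ψ (proj z) - u (proj z) i) (by
      rw [Prod.dist_eq, Prod.dist_eq, dist_eq_norm, dist_eq_norm, Real.dist_eq, sub_zero]
      refine max_lt (by linarith) (max_lt (by linarith) ?_)
      rw [abs_of_nonneg (sub_nonneg.2 hz)]
      simp only [Function.comp_apply] at hs
      linarith)
    simp only [hQ, hzz] at this
    exact this.le
  obtain ⟨hw, hstrict⟩ := S.isSubsolution_replaceComp_max husub i hψ hδ0.le hmain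
  set w := replaceComp u i fun x => max (u x i) (ψ x) with hwdef
  -- `w` exceeds the Mañé column at `x` in component `i`; by maximality this requires `w y k > 0 = u
  -- y k`. Only component `i` changed, so `i = k` and `y` lies where `ψ > u k`.
  have hwk : 0 < w y k := by
    by_contra! hle
    have h1 := S.le_mane hw i k y (proj x)
    have h2 : w (proj x) i = max (u (proj x) i) (ψ (proj x)) := by simp [hwdef, replaceComp]
    have h3 : ψ (proj x) ≤ w (proj x) i := h2 ▸ le_max_right _ _
    simp only [Function.comp_apply] at hψx
    have h4 : u (proj x) i = mane H B i k y (proj x) := rfl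
    linarith
  have hki : k = i := by
    by_contra hne
    simp [hwdef, replaceComp, hne, huy] at hwk
  subst hki
  have hψy : u y k < ψ y := by
    simpa [hwdef, replaceComp, huy] using hwk
  refine ⟨w, hw, {x | u x k < ψ x}, isOpen_lt ((continuous_apply k).comp husub.1) hψ, hψy, δ, hδ0,
    fun z p hz hp => hstrict z p (le_of_lt hz) hp⟩

/-- Strictness propagates from one component to the components coupled with it. -/
lemma Admissible.exists_viscStrictAt_of_coupled (S : Admissible H B) {v : Torus N → Fin m → ℝ}
    (hv : IsSubsolution H B (fun _ => 0) v) {i j : Fin m} {y : Torus N}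
    (hj : ViscStrictAt H B v j y) (hij : i ≠ j) (hB : B y i j ≠ 0) :
    ∃ w, IsSubsolution H B (fun _ => 0) w ∧ ViscStrictAt H B w i y ∧
      ∀ l, ViscStrictAt H B v l y → ViscStrictAt H B w l y := by
  obtain ⟨C, L, -, hL0, hbd⟩ := S.exists_bounds
  have hL := (hbd v (hv.mono zero_le_one)).2
  have hv' := (S.isSubsolution_iff.1 hv).2
  obtain ⟨V, hV, hyV, δ, hδ, hle⟩ := hj
  obtain ⟨θ, hθc, hθs, hθ0, hθ1, hθV⟩ := exists_smooth_support_eq hV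
  obtain ⟨K, hK0, hK⟩ := exists_gradient_bound hθs
  obtain ⟨η, hη, hmod⟩ := exists_modulus (S.continuous_ham j) (L + 1)
    (by positivity : 0 < δ / 4)
  obtain ⟨D, hD0, hD⟩ := exists_abs_le_of_continuous (S.continuous_entry j j)
  -- The slack `δ` of equation `j` pays `δ / 4` for the change of slope in `H j` and `δ / 4` for the
  -- diagonal coupling term; `δ / 2` remains.
  set t := min (min 1 η / (K + 1)) (δ / 4 / (D + 1))
  have ht0 : 0 < t := by positivity
  have htK : t * K ≤ min 1 η := by
    have : t * (K + 1) ≤ min 1 η := by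
      rw [← le_div_iff₀ (by positivity)]; exact min_le_left _ _
    nlinarith
  have htD : t * D ≤ δ / 4 := by
    have : t * (D + 1) ≤ δ / 4 := by
      rw [← le_div_iff₀ (by positivity)]; exact min_le_right _ _
    nlinarith
  -- Raising component `j` inside `V` lowers the left-hand sides of the other equations by `|B x l
  -- j| * t * θ x`, strictly for `l = i` near `y`.
  set f : Torus N → ℝ := fun x => v x j + t * θ x with hf
  set w := replaceComp v j f with hw
  have hvf : ∀ x, v x j ≤ f x := fun x => by
    have := mul_nonneg ht0.le (hθ0 x)
    simp only [hf]; linarith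
  have hwc : Continuous w := continuous_replaceComp hv.1 j
    (((continuous_apply j).comp hv.1).add (continuous_const.mul hθc))
  have hθd : Differentiable ℝ fun z => θ (proj z) := hθs.differentiable (by simp)
  have hpj : ∀ z p, FrechetSuper (liftComp w j) z p → ∃ g, HasGradientAt (fun z => θ (proj z)) g z ∧
      FrechetSuper (liftComp v j) z (p - t • g) := by
    intro z p hp
    refine ⟨_, (hθd z).hasGradientAt, ?_⟩
    rw [hw, liftComp_replaceComp_self] at hp
    refine FrechetSuper.sub_gradient (g := fun z => t * θ (proj z)) hp ?_
    have := (hθd z).hasGradientAt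
    rw [hasGradientAt_iff_hasFDerivAt] at *
    rw [map_smul]
    exact this.const_mul t
  have hjV : ∀ z p, proj z ∈ V → FrechetSuper (liftComp w j) z p →
      lhs H B w j (proj z) p ≤ -(δ / 2) := by
    intro z p hz hp
    obtain ⟨g, hg, hpv⟩ := hpj z p hp
    have h1 := hle z _ hz hpv
    have h2 : ‖p - t • g‖ ≤ L := hpv.norm_le hL0 (hL j)
    have h3 : ‖t • g‖ ≤ min 1 η := by
      rw [norm_smul, Real.norm_of_nonneg ht0.le]
      exact (mul_le_mul_of_nonneg_left (hK z g hg) ht0.le).trans htK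
    have h4 : ‖p‖ ≤ L + 1 := by
      calc ‖p‖ = ‖(p - t • g) + t • g‖ := by rw [sub_add_cancel]
        _ ≤ L + 1 := (norm_add_le _ _).trans (add_le_add h2 (h3.trans (min_le_left _ _)))
    have h5 := (abs_le.1 (hmod (proj z) (proj z) p (p - t • g) h4 (by linarith)
      (by simpa using hη.le) (by rw [sub_sub_cancel]; exact h3.trans (min_le_right _ _)))).2
    rw [hw, lhs_replaceComp]
    have h6 : B (proj z) j j * (f (proj z) - v (proj z) j) ≤ δ / 4 := by
      simp only [hf, add_sub_cancel_left]
      have e1 := (abs_le.1 (hD (proj z))).2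
      have e2 : 0 ≤ t * θ (proj z) := mul_nonneg ht0.le (hθ0 _)
      calc B (proj z) j j * (t * θ (proj z)) ≤ D * (t * θ (proj z)) :=
            mul_le_mul_of_nonneg_right e1 e2
        _ ≤ D * (t * 1) := by gcongr; exact hθ1 _
        _ ≤ δ / 4 := by linarith
    simp only [lhs] at h1 h5 ⊢
    linarith
  have hother : ∀ l, l ≠ j → ∀ z p, FrechetSuper (liftComp w l) z p →
      FrechetSuper (liftComp v l) z p ∧ lhs H B w l (proj z) p ≤ lhs H B v l (proj z) p := by
    intro l hl z p hp
    rw [hw, liftComp_replaceComp_of_ne _ hl] at hp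
    exact ⟨hp, S.lhs_replaceComp_le v hl (hvf _) p⟩
  have hwsub : IsSubsolution H B (fun _ => 0) w := by
    refine S.isSubsolution_iff.2 ⟨hwc, fun l z p hp => ?_⟩
    by_cases hl : l = j
    · subst hl
      by_cases hz : proj z ∈ V
      · exact (hjV z p hz hp).trans (by linarith)
      · obtain ⟨g, hg, hpv⟩ := hpj z p hp
        have hθz : θ (proj z) = 0 := by
          by_contra hne; exact hz ((hθV _).1 hne)
        -- Outside `V` the bump is at its minimum 0, so it does not alter supergradients.
        have hg0 : g = 0 := by
          have hmin : IsLocalMin (fun z => θ (proj z)) z :=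
            .of_forall fun y => by simpa [hθz] using hθ0 (proj y)
          have h1 := hmin.fderiv_eq_zero
          rw [hg.hasFDerivAt.fderiv] at h1
          simpa using h1
        rw [hg0, smul_zero, sub_zero] at hpv
        rw [hw, lhs_replaceComp]
        simp only [hf, hθz, mul_zero, add_zero, sub_self]
        exact hv' l z p hpv
    · obtain ⟨h1, h2⟩ := hother l hl z p hp
      exact h2.trans (hv' l z p h1)
  refine ⟨w, hwsub, ?_, fun l hl => ?_⟩
  · have hneg : B y i j < 0 := lt_of_le_of_ne ((S.coupling y).1 i j hij.symm) hB
    have hθy : 0 < θ y := lt_of_le_of_ne (hθ0 y) (Ne.symm ((hθV y).2 hyV))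
    set c := B y i j * (t * θ y) with hcdef
    have hc : c < 0 := mul_neg_of_neg_of_pos hneg (by positivity)
    refine ⟨{x | B x i j * (t * θ x) < c / 2}, isOpen_lt ((S.continuous_entry i j).mul
      (continuous_const.mul hθc)) continuous_const, ?_, -(c / 2), by linarith, fun z p hz hp => ?_⟩
    · change c < c / 2
      linarith
    · have hz' : B (proj z) i j * (t * θ (proj z)) < c / 2 := hz
      have h1 := hv' i z p (hother i hij z p hp).1
      rw [hw, lhs_replaceComp]
      simp only [hf, add_sub_cancel_left]
      linarith
  · by_cases hlj : l = j
    · subst hlj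
      exact ⟨V, hV, hyV, δ / 2, by positivity, hjV⟩
    · obtain ⟨V', hV', hyV', δ', hδ', hle'⟩ := hl
      refine ⟨V', hV', hyV', δ', hδ', fun z p hz hp => ?_⟩
      obtain ⟨h1, h2⟩ := hother l hlj z p hp
      exact h2.trans (hle' z p hz h1)

/-- Outside the Aubry set there is a critical subsolution all of whose components are strict. -/
lemma Admissible.exists_forall_viscStrictAt (S : Admissible H B) (hc : IsCriticalValue H B 0)
    {k : Fin m} {y : Torus N} (hy : y ∉ aubrySet H B k) :
    ∃ w, IsSubsolution H B (fun _ => 0) w ∧ ∀ i, ViscStrictAt H B w i y := by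
  classical
  -- Induction on the number of strict components at `y`; irreducibility for the non-strict ones
  -- yields one coupled to a strict component.
  have key : ∀ n, n ≤ m → ∃ w, IsSubsolution H B (fun _ => 0) w ∧ ViscStrictAt H B w k y ∧
      n ≤ (Finset.univ.filter fun i => ViscStrictAt H B w i y).card := by
    intro n
    induction n with
    | zero =>
      intro _
      obtain ⟨w, hw, hk⟩ := S.exists_viscStrictAt_of_notMem hc hy
      exact ⟨w, hw, hk, Nat.zero_le _⟩
    | succ n ih =>
      intro hn
      obtain ⟨w, hw, hk, hcard⟩ := ih (by omega)
      by_cases hall : ∀ i, ViscStrictAt H B w i y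
      · refine ⟨w, hw, hk, ?_⟩
        rw [Finset.filter_true_of_mem fun i _ => hall i]
        simpa using hn
      · push Not at hall
        obtain ⟨i, hi, j, hj, hB⟩ := S.irred y {i | ¬ ViscStrictAt H B w i y} hall
          (fun h => (h ▸ mem_univ k : k ∈ {i | ¬ ViscStrictAt H B w i y}) hk)
        have hj' : ViscStrictAt H B w j y := not_not.1 hj
        have hij : i ≠ j := fun h => hi (h ▸ hj')
        obtain ⟨w', hw', hi', hl'⟩ := S.exists_viscStrictAt_of_coupled hw hj' hij hB
        refine ⟨w', hw', hl' k hk, ?_⟩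
        refine lt_of_le_of_lt hcard (Finset.card_lt_card ?_)
        refine Finset.ssubset_iff_subset_ne.2 ⟨fun l hl => ?_, fun h => ?_⟩
        · simp only [Finset.mem_filter, Finset.mem_univ, true_and] at hl ⊢
          exact hl' l hl
        · have : i ∈ Finset.univ.filter fun i => ViscStrictAt H B w i y := by
            rw [h]; simpa using hi'
          exact hi (by simpa using this)
  obtain ⟨w, hw, -, hcard⟩ := key m le_rfl
  refine ⟨w, hw, fun i => ?_⟩
  have h1 : (Finset.univ.filter fun i => ViscStrictAt H B w i y) = Finset.univ :=
    (Finset.card_eq_iff_eq_univ _).1 (le_antisymm (Finset.card_le_univ _) (by simpa using hcard))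
  have h2 : i ∈ Finset.univ.filter fun i => ViscStrictAt H B w i y := by
    rw [h1]; exact Finset.mem_univ i
  simpa using h2

end Strict

end WeaklyCoupled

namespace WeaklyCoupled

open Filter Metric Set MeasureTheory

/-! ### A subsolution strict outside the Aubry set -/

/-- A closed convex set is stable under countable convex combinations. -/
lemma _root_.Convex.hasSum_mem {E : Type*} [AddCommGroup E] [Module ℝ E] [TopologicalSpace E]
    [ContinuousAdd E] [ContinuousSMul ℝ E] {K : Set E} (hK : Convex ℝ K) (hcl : IsClosed K) {c : ℕ → ℝ}
    (hc0 : ∀ n, 0 ≤ c n) (hc : HasSum c 1) {w : ℕ → E} (hw : ∀ n, w n ∈ K) {v : E}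
    (hv : HasSum (fun n => c n • w n) v) : v ∈ K := by
  have h1 := hv.tendsto_sum_nat
  have h2 := hc.tendsto_sum_nat
  -- Putting the missing mass on `w 0` turns partial sums into genuine convex combinations with the
  -- same limit.
  have h3 : Tendsto (fun n => ∑ j ∈ Finset.range n, c j • w j +
      (1 - ∑ j ∈ Finset.range n, c j) • w 0) atTop (𝓝 (v + (1 - 1 : ℝ) • w 0)) :=
    h1.add ((h2.const_sub 1).smul_const (w 0))
  rw [sub_self, zero_smul, add_zero] at h3
  refine hcl.mem_of_tendsto h3 (.of_forall fun n => ?_)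
  have hle : ∑ j ∈ Finset.range n, c j ≤ 1 := sum_le_hasSum _ (fun j _ => hc0 j) hc
  have h4 := hK.sum_mem (t := Finset.range (n + 1))
    (w := fun j => if j < n then c j else 1 - ∑ j ∈ Finset.range n, c j)
    (z := fun j => if j < n then w j else w 0) (fun j _ => by split_ifs <;> simp [hc0, hle])
    (by
      rw [Finset.sum_range_succ, Finset.sum_congr rfl fun j hj => if_pos (Finset.mem_range.1 hj)]
      simp)
    (fun j _ => by split_ifs <;> exact hw _)
  rw [Finset.sum_range_succ] at h4
  rw [Finset.sum_congr rfl fun j hj => by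
    rw [if_pos (Finset.mem_range.1 hj), if_pos (Finset.mem_range.1 hj)]] at h4
  simpa using h4

section Strict

variable {N m : ℕ} {H : Fin m → Torus N → Eucl N → ℝ}
  {B : Torus N → Matrix (Fin m) (Fin m) ℝ}

lemma Admissible.convex_criticalSubsolutions (S : Admissible H B) :
    Convex ℝ (criticalSubsolutions H B) := by
  intro u hu v hv s t hs ht hst
  exact S.isSubsolution_convex_comb (mem_criticalSubsolutions.1 hu) (mem_criticalSubsolutions.1 hv)
    hs ht hst

lemma Admissible.isClosed_criticalSubsolutions (S : Admissible H B) :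
    IsClosed (criticalSubsolutions H B) := by
  refine isClosed_of_closure_subset fun u hu => ?_
  refine S.isSubsolution_of_approx u.continuous fun x i η hη => ?_
  obtain ⟨v, hv, hd⟩ := Metric.mem_closure_iff.1 hu η hη
  have h1 : ∀ y j, |u y j - v y j| ≤ η := fun y j =>
    ((norm_le_pi_norm ((u - v) y) j).trans ((u - v).norm_coe_le_norm y)).trans
      (by rw [← dist_eq_norm]; exact hd.le)
  refine ⟨v, IsSubsolution.mono hv (by linarith), fun y j => ?_, ?_⟩
  · linarith [(abs_le.1 (h1 y j)).1]
  · linarith [(abs_le.1 (h1 x i)).2]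

lemma isOpen_isStrictCompAt (v : Torus N → Fin m → ℝ) (i : Fin m) :
    IsOpen {y | IsStrictCompAt H B v i y} := by
  rw [isOpen_iff_mem_nhds]
  rintro y ⟨V, hV, hy, h⟩
  filter_upwards [hV.mem_nhds hy] with x hx
  exact ⟨V, hV, hx, h⟩

lemma Admissible.isStrictCompAt_add_const (S : Admissible H B) {v : Torus N → Fin m → ℝ}
    {i : Fin m} {y : Torus N} (h : IsStrictCompAt H B v i y) (c : ℝ) :
    IsStrictCompAt H B (fun x j => v x j + c) i y := by
  obtain ⟨V, hV, hy, δ, hδ, hae⟩ := h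
  refine ⟨V, hV, hy, δ, hδ, ?_⟩
  filter_upwards [hae] with z hz hzV
  obtain ⟨p, hp, hlt⟩ := hz hzV
  refine ⟨p, ?_, ?_⟩
  · rw [hasGradientAt_iff_hasFDerivAt] at *
    exact hp.add_const c
  · simpa [lhs, mulVec_add_const (S.deg _)] using hlt

/-- There is a critical subsolution that is strict outside the Aubry set. -/
lemma Admissible.exists_isStrictIn (S : Admissible H B) (hc : IsCriticalValue H B 0) (k : Fin m) :
    ∃ v ∈ criticalSubsolutions H B, IsStrictIn H B v (aubrySet H B k)ᶜ := by
  obtain ⟨K, L, hK0, hL0, hbd⟩ := S.exists_uniform_bounds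
  -- The normalization at `0` bounds all members uniformly, so weighted series of them converge.
  let ι := {w : C(Torus N, Fin m → ℝ) // w ∈ criticalSubsolutions H B ∧ w 0 k = 0}
  have hnorm : ∀ u : Torus N → Fin m → ℝ, IsSubsolution H B (fun _ => 0) u →
      ∃ w : ι, ∀ x i, w.1 x i = u x i + -u 0 k := by
    intro u hu
    have h1 := S.isSubsolution_add_const hu (-u 0 k)
    exact ⟨⟨⟨_, h1.1⟩, h1, by simp⟩, fun x i => rfl⟩
  let s : ι → Set (Torus N) := fun w => ⋂ i, {y | IsStrictCompAt H B w.1 i y}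
  have hs : ∀ w, IsOpen (s w) := fun w => isOpen_iInter_of_finite fun i => isOpen_isStrictCompAt _ _
  obtain ⟨u0, hu0⟩ := S.exists_isSubsolution_zero hc k
  obtain ⟨w0, -⟩ := hnorm u0 hu0
  obtain ⟨T, hT, hTs⟩ := TopologicalSpace.isOpen_iUnion_countable s hs
  -- Lindelöf gives a countable subcover; adding `w0` allows it to be listed as a sequence even when
  -- it is empty.
  obtain ⟨w, hw⟩ := (hT.insert w0).exists_eq_range (insert_nonempty _ _)
  have hcover : ∀ y ∈ (aubrySet H B k)ᶜ, ∃ n, ∀ i, IsStrictCompAt H B (w n).1 i y := by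
    intro y hy
    obtain ⟨u, hu, hstrict⟩ := S.exists_forall_viscStrictAt hc hy
    obtain ⟨u', hu'⟩ := hnorm u hu
    have h1 : y ∈ ⋃ w, s w := by
      refine mem_iUnion.2 ⟨u', mem_iInter.2 fun i => ?_⟩
      have h2 := S.isStrictCompAt_add_const (S.isStrictCompAt_of_viscStrictAt hu (hstrict i))
        (-u 0 k)
      have h3 : (fun x j => u x j + -u 0 k) = u'.1 := by funext x j; rw [hu']
      rw [h3] at h2
      exact h2
    rw [← hTs] at h1
    obtain ⟨w', hw'T, hy'⟩ := mem_iUnion₂.1 h1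
    obtain ⟨n, rfl⟩ : w' ∈ range w := hw ▸ mem_insert_of_mem _ hw'T
    exact ⟨n, fun i => mem_iInter.1 hy' i⟩
  have hwn : ∀ n, ‖(w n).1‖ ≤ K := by
    intro n
    refine (ContinuousMap.norm_le _ hK0).2 fun x => (pi_norm_le_iff_of_nonneg hK0).2 fun i => ?_
    have h1 : IsSubsolution H B (fun _ => 0) (w n).1 := (w n).2.1
    have h2 := (hbd _ (h1.mono zero_le_one)).2.2 x 0 i k
    rwa [(w n).2.2, sub_zero] at h2
  set c : ℕ → ℝ := fun n => 1 / 2 / 2 ^ n with hcdef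
  have hc0 : ∀ n, 0 < c n := fun n => by positivity
  have hcs : HasSum c 1 := hasSum_geometric_two' 1
  have hc1 : ∀ n, c n < 1 := fun n => by
    have : (1 : ℝ) ≤ 2 ^ n := one_le_pow₀ (by norm_num)
    simp only [hcdef]
    rw [div_lt_one (by positivity)]; linarith
  have hsum : Summable fun n => c n • (w n).1 := by
    refine Summable.of_norm_bounded (hcs.summable.mul_right K) fun n => ?_
    rw [norm_smul, Real.norm_of_nonneg (hc0 n).le]
    exact mul_le_mul_of_nonneg_left (hwn n) (hc0 n).le
  obtain ⟨v, hv⟩ := hsum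
  refine ⟨v, S.convex_criticalSubsolutions.hasSum_mem S.isClosed_criticalSubsolutions
    (fun n => (hc0 n).le) hcs (fun n => (w n).2.1) hv, fun y hy i => ?_⟩
  obtain ⟨n, hn⟩ := hcover y hy
  have hpos : 0 < 1 - c n := by linarith [hc1 n]
  -- Split off the term strict at `y`: the remaining terms, renormalized by `1 - c n`, again form a
  -- countable convex combination, hence a critical subsolution.
  have hcs' : HasSum (fun l => (1 - c n)⁻¹ * (c l - if l = n then c n else 0)) 1 := by
    have := (hcs.sub (hasSum_ite_eq n (c n))).mul_left (1 - c n)⁻¹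
    rwa [inv_mul_cancel₀ hpos.ne'] at this
  have hv' : HasSum (fun l => ((1 - c n)⁻¹ * (c l - if l = n then c n else 0)) • (w l).1)
      ((1 - c n)⁻¹ • (v - c n • (w n).1)) := by
    have h1 := (hv.sub (hasSum_ite_eq n (c n • (w n).1))).const_smul (1 - c n)⁻¹
    have h2 : (fun l => ((1 - c n)⁻¹ * (c l - if l = n then c n else 0)) • (w l).1) =
        fun l => (1 - c n)⁻¹ • (c l • (w l).1 - if l = n then c n • (w n).1 else 0) := by
      funext l
      rw [mul_smul, sub_smul]
      split_ifs with h
      · rw [h]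
      · rw [zero_smul]
    rw [h2]; exact h1
  have hrest := S.convex_criticalSubsolutions.hasSum_mem S.isClosed_criticalSubsolutions
    (fun l => ?_) hcs' (fun l => (w l).2.1) hv'
  · have h1 := S.isStrictCompAt_convex_comb (mem_criticalSubsolutions.1 hrest) (hn i) hpos.le
      (hc0 n) (by ring)
    have h2 : (1 - c n) • ⇑((1 - c n)⁻¹ • (v - c n • (w n).1)) + c n • ⇑(w n).1 = v := by
      funext x j
      simp only [Pi.add_apply, Pi.smul_apply, ContinuousMap.smul_apply, ContinuousMap.sub_apply,
        smul_eq_mul, Pi.sub_apply]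
      rw [mul_inv_cancel_left₀ hpos.ne']; ring
    rwa [h2] at h1
  · refine mul_nonneg (inv_nonneg.2 hpos.le) ?_
    split_ifs with h
    · simp [h]
    · simpa using (hc0 l).le

end Strict

end WeaklyCoupled

namespace WeaklyCoupled

open Filter Metric Set MeasureTheory

/-! ### Smooth approximation -/

/-- Construction of a smooth positive function on `(0, ∞)` that is, together with its derivative,
as small as desired near each point. -/
lemma exists_smooth_small {Good : ℝ → ℝ → Prop} (hex : ∀ s > 0, ∃ h > 0, Good s h)
    (hmono : ∀ s s' h h', Good s h → s ≤ s' → 0 < h' → h' ≤ h → Good s' h') :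
    ∃ χ : ℝ → ℝ, Continuous χ ∧ χ 0 = 0 ∧ (∀ s > 0, ContDiffAt ℝ ∞ χ s) ∧
      ∀ s, 0 < s → s ≤ 1 → 0 < χ s ∧ χ s ≤ s ∧
        ∃ h, Good s h ∧ χ s ≤ h ∧ |deriv χ s| ≤ h := by
  -- In the variable `τ = log s` the half-line becomes `ℝ`. The admissible values form intervals, so
  -- locally constant choices glue by a partition of unity.
  obtain ⟨G, hG⟩ := exists_contMDiffMap_forall_mem_convex_of_local_const (n := ⊤)
    (I := modelWithCornersSelf ℝ ℝ) (M := ℝ) (F := ℝ)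
    (t := fun τ => {c | 0 < c ∧ c ≤ 1 ∧ Good (Real.exp τ) c})
    (fun τ => by
      refine Set.OrdConnected.convex ⟨fun a ha b hb c hc => ?_⟩
      have h0 : 0 < c := ha.1.trans_le hc.1
      exact ⟨h0, hc.2.trans hb.2.1, hmono _ _ _ _ hb.2.2 le_rfl h0 hc.2⟩)
    (fun τ => by
      -- A value good at `exp (τ - 1)` is good for all larger arguments, hence in a neighbourhood of
      -- `τ`.
      obtain ⟨h, hh0, hh⟩ := hex (Real.exp (τ - 1)) (Real.exp_pos _)
      refine ⟨min h 1, ?_⟩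
      filter_upwards [lt_mem_nhds (sub_one_lt τ)] with σ hσ
      exact ⟨by positivity, min_le_right _ _, hmono _ _ _ _ hh (Real.exp_le_exp.2 hσ.le)
        (by positivity) (min_le_left _ _)⟩)
  have hGs : ContDiff ℝ ∞ G := contMDiff_iff_contDiff.1 G.contMDiff
  set g : ℝ → ℝ := fun s => G (Real.log s) with hg
  have hg0 : ∀ s, 0 < g s := fun s => (hG _).1
  have hg1 : ∀ s, g s ≤ 1 := fun s => (hG _).2.1
  have hgood : ∀ s > 0, Good s (g s) := fun s hs => by
    have := (hG (Real.log s)).2.2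
    rwa [Real.exp_log hs] at this
  have hgm : Measurable g := hGs.continuous.measurable.comp Real.measurable_log
  have hgs : ∀ s > 0, ContDiffAt ℝ ∞ g s := fun s hs =>
    hGs.contDiffAt.comp s (Real.contDiffAt_log.2 hs.ne')
  have hgi : ∀ a b, IntervalIntegrable g volume a b := fun a b => by
    rw [intervalIntegrable_iff]
    refine Measure.integrableOn_of_bounded (M := 1) (by simp) hgm.aestronglyMeasurable
      (.of_forall fun s => ?_)
    rw [Real.norm_of_nonneg (hg0 s).le]; exact hg1 s
  -- Taking a primitive controls `χ` and `χ'` by the same `g`: `χ' = g`, and `χ s = s * g t` for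
  -- some `t < s` by the mean value theorem.
  set χ : ℝ → ℝ := fun s => ∫ t in (0 : ℝ)..s, g t with hχ
  have hχc : Continuous χ := intervalIntegral.continuous_primitive hgi 0
  have hχd : ∀ s > 0, HasDerivAt χ (g s) s := fun s hs =>
    intervalIntegral.integral_hasDerivAt_right (hgi 0 s)
      (hgm.stronglyMeasurable.stronglyMeasurableAtFilter) (hgs s hs).continuousAt
  refine ⟨χ, hχc, by simp [hχ], fun s hs => ?_, fun s hs hs1 => ?_⟩
  · have h1 : ContDiffOn ℝ ∞ χ (Ioi 0) := by
      rw [contDiffOn_infty_iff_deriv_of_isOpen isOpen_Ioi]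
      refine ⟨fun t ht => (hχd t ht).differentiableAt.differentiableWithinAt, ?_⟩
      have h2 : ContDiffOn ℝ ∞ g (Ioi 0) := fun t ht => (hgs t ht).contDiffWithinAt
      exact h2.congr fun t ht => (hχd t ht).deriv
    exact h1.contDiffAt (Ioi_mem_nhds hs)
  · obtain ⟨t, ht, hslope⟩ := exists_hasDerivAt_eq_slope χ g hs hχc.continuousOn
      fun t ht => hχd t ht.1
    have hχ0 : χ 0 = 0 := by simp [hχ]
    have hχs : χ s = s * g t := by
      rw [hslope, hχ0, sub_zero, sub_zero, mul_div_cancel₀ _ hs.ne']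
    have hgt := hmono _ _ _ _ (hgood t ht.1) ht.2.le (hg0 t) le_rfl
    refine ⟨hχs ▸ mul_pos hs (hg0 t), hχs ▸ mul_le_of_le_one_right hs.le (hg1 t),
      -- The maximum is one of the two values, and both are good at `s`.
      max (g t) (g s), ?_, ?_, ?_⟩
    · rcases max_choice (g t) (g s) with h | h <;> rw [h]
      exacts [hgt, hgood s hs]
    · rw [hχs]
      exact (mul_le_of_le_one_left (hg0 t).le hs1).trans (le_max_left _ _)
    · rw [(hχd s hs).deriv, abs_of_pos (hg0 s)]
      exact le_max_right _ _

section Smoothing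

variable {N m : ℕ} {H : Fin m → Torus N → Eucl N → ℝ}
  {B : Torus N → Matrix (Fin m) (Fin m) ℝ}

/-- Strictness is uniform on compact sets. -/
lemma IsStrictIn.exists_uniform {v : Torus N → Fin m → ℝ} {U K : Set (Torus N)}
    (h : IsStrictIn H B v U) (hK : IsCompact K) (hKU : K ⊆ U) :
    ∃ ρ > 0, ∃ δ > 0, ∀ x ∈ K, ∀ i, ∀ᵐ z : Eucl N, dist (proj z) x ≤ ρ →
      ∃ p, HasGradientAt (liftComp v i) p z ∧ lhs H B v i (proj z) p ≤ -δ := by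
  refine hK.induction_on (p := fun K => ∃ ρ > 0, ∃ δ > 0, ∀ x ∈ K, ∀ i, ∀ᵐ z : Eucl N,
    dist (proj z) x ≤ ρ → ∃ p, HasGradientAt (liftComp v i) p z ∧ lhs H B v i (proj z) p ≤ -δ)
    ⟨1, one_pos, 1, one_pos, by simp⟩ ?_ ?_ ?_
  · rintro s t hst ⟨ρ, hρ, δ, hδ, hall⟩
    exact ⟨ρ, hρ, δ, hδ, fun x hx => hall x (hst hx)⟩
  · rintro s t ⟨ρ, hρ, δ, hδ, hs⟩ ⟨ρ', hρ', δ', hδ', ht⟩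
    refine ⟨min ρ ρ', lt_min hρ hρ', min δ δ', lt_min hδ hδ', fun x hx i => ?_⟩
    rcases hx with hx | hx
    · filter_upwards [hs x hx i] with z hz hd
      obtain ⟨p, hp, hle⟩ := hz (hd.trans (min_le_left _ _))
      exact ⟨p, hp, hle.trans (neg_le_neg (min_le_left _ _))⟩
    · filter_upwards [ht x hx i] with z hz hd
      obtain ⟨p, hp, hle⟩ := hz (hd.trans (min_le_right _ _))
      exact ⟨p, hp, hle.trans (neg_le_neg (min_le_right _ _))⟩
  · intro y hy
    choose V hV hyV δ hδ hae using h y (hKU hy)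
    obtain ⟨c, hc, hcδ⟩ := exists_pos_forall_le hδ
    have hnhds : ⋂ i, V i ∈ 𝓝 y := (isOpen_iInter_of_finite hV).mem_nhds (mem_iInter.2 hyV)
    obtain ⟨ρ, hρ, hball⟩ := Metric.mem_nhds_iff.1 hnhds
    refine ⟨ball y (ρ / 2), mem_nhdsWithin_of_mem_nhds (ball_mem_nhds y (by positivity)),
      ρ / 3, by positivity, c, hc, fun x hx i => ?_⟩
    filter_upwards [hae i] with z hz hd
    have hzy : proj z ∈ ball y ρ := by
      rw [mem_ball] at hx ⊢
      linarith [dist_triangle (proj z) x y]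
    obtain ⟨p, hp, hlt⟩ := hz (mem_iInter.1 (hball hzy) i)
    exact ⟨p, hp, by linarith [hcδ i]⟩

/-- A subsolution that is smooth, with negative left-hand sides, in an open set is strict there. -/
lemma Admissible.isStrictIn_of_smooth (S : Admissible H B) {w : Torus N → Fin m → ℝ}
    (hw : Continuous w) {U : Set (Torus N)} (hU : IsOpen U) (hs : IsSmoothIn w U)
    (hneg : ∀ z, proj z ∈ U → ∀ i, ∃ q, HasGradientAt (liftComp w i) q z ∧
      lhs H B w i (proj z) q < 0) : IsStrictIn H B w U := by
  intro y hy i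
  obtain ⟨z₀, rfl⟩ := proj_surjective y
  have hgc : ContinuousAt (fun z => gradient (liftComp w i) z) z₀ := by
    have h1 : ContDiffAt ℝ 0 (fderiv ℝ (liftComp w i)) z₀ :=
      (hs z₀ hy i).fderiv_right (by simp)
    exact (LinearIsometryEquiv.continuous _).continuousAt.comp h1.continuousAt
  have hlc : ContinuousAt (fun z => lhs H B w i (proj z) (gradient (liftComp w i) z)) z₀ := by
    have h1 : ContinuousAt (fun z => H i (proj z) (gradient (liftComp w i) z)) z₀ :=
      ContinuousAt.comp (f := fun z => (proj z, gradient (liftComp w i) z))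
        (S.continuous_ham i).continuousAt (continuous_proj.continuousAt.prodMk hgc)
    exact h1.add ((S.continuous_mulVec hw i).comp continuous_proj).continuousAt
  obtain ⟨q₀, hq₀, hlt₀⟩ := hneg z₀ hy i
  rw [← hq₀.gradient] at hlt₀
  set δ := -lhs H B w i (proj z₀) (gradient (liftComp w i) z₀) / 2 with hδ
  have hev := (hlc.eventually (gt_mem_nhds (by linarith :
    lhs H B w i (proj z₀) (gradient (liftComp w i) z₀) < -δ))).and
    (continuous_proj.continuousAt.eventually (hU.mem_nhds hy))
  obtain ⟨ρ, hρ, hball⟩ := Metric.eventually_nhds_iff.1 hev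
  -- Lifting a torus distance can cost a factor `N`, hence the smaller radius.
  refine ⟨ball (proj z₀) (ρ / (N + 1)), isOpen_ball, mem_ball_self (by positivity), δ,
    by linarith, .of_forall fun z hz => ?_⟩
  obtain ⟨z', hz', -, hn⟩ := exists_lift_near (proj z) z₀
  have hd : dist z' z₀ < ρ := by
    rw [dist_eq_norm]
    rw [mem_ball, lt_div_iff₀ (by positivity)] at hz
    nlinarith [dist_nonneg (x := proj z) (y := proj z₀)]
  obtain ⟨h1, h2⟩ := hball hd
  obtain ⟨q, hq, -⟩ := hneg z' h2 i
  rw [hq.gradient, hz'] at h1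
  exact ⟨q, hasGradientAt_of_proj_eq (θ := fun x => w x i) hz' hq, h1⟩

/-- Smooth approximation of a critical subsolution that is strict outside a closed set. -/
lemma Admissible.exists_smooth_approx (S : Admissible H B) {v : Torus N → Fin m → ℝ}
    (hv : IsSubsolution H B (fun _ => 0) v) {A : Set (Torus N)} (hA : IsClosed A)
    (hstrict : IsStrictIn H B v Aᶜ) {ε : ℝ} (hε : 0 < ε) :
    ∃ w, IsSubsolution H B (fun _ => 0) w ∧ (∀ x, ‖w x - v x‖ ≤ ε) ∧ (∀ x ∈ A, w x = v x) ∧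
      IsSmoothIn w Aᶜ ∧ IsStrictIn H B w Aᶜ := by
  obtain ⟨C, L, -, hL0, hbd⟩ := S.exists_bounds
  have hL := (hbd v (hv.mono zero_le_one)).2
  obtain ⟨f, hfc, hfs, hf0, hf1, hfA⟩ := exists_smooth_support_eq hA.isOpen_compl
  obtain ⟨K, hK0, hK⟩ := exists_gradient_bound hfs
  have hfpos : ∀ x, x ∈ Aᶜ → 0 < f x := fun x hx =>
    lt_of_le_of_ne (hf0 x) (Ne.symm ((hfA x).2 hx))
  have hfzero : ∀ x, x ∈ A → f x = 0 := fun x hx => by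
    by_contra hne; exact (hfA x).1 hne hx
  have hfd : Differentiable ℝ fun z => f (proj z) := hfs.differentiable (by simp)
  -- `Good s h` quantifies over all radius functions because the actual one, `χ ∘ f`, is not yet
  -- known; the bound `h * K` fits its gradient `χ' ∇f`.
  obtain ⟨χ, hχc, hχ0, hχs, hχ⟩ := exists_smooth_small (Good := fun s h => L * h ≤ ε ∧
    ∀ (r : Torus N → ℝ) (z₀ g : Eucl N), s ≤ f (proj z₀) → 0 < r (proj z₀) → r (proj z₀) ≤ h →
      HasGradientAt (fun z => r (proj z)) g z₀ → ‖g‖ ≤ h * K → ∀ i,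
      ∃ q, HasGradientAt (liftComp (mollifyVec v r) i) q z₀ ∧
        lhs H B (mollifyVec v r) i (proj z₀) q < 0)
    (fun s hs => by
      obtain ⟨ρ, hρ, δ, hδ, hunif⟩ := hstrict.exists_uniform (K := {x | s ≤ f x})
        (isClosed_le continuous_const hfc).isCompact
        (fun x hx => (hfA x).1 (hs.trans_le hx).ne')
      obtain ⟨h, hh0, hh⟩ := S.exists_lhs_mollifyVec_le hv.1 hL0 hL (half_pos hδ)
      -- The three bounds serve closeness to `v`, averaging only where the slack `δ` is uniform, and
      -- a mollification error of at most `δ / 2`.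
      refine ⟨min (ε / (L + 1)) (min ρ (h / (K + 1))), by positivity, ?_, ?_⟩
      · have h1 : min (ε / (L + 1)) (min ρ (h / (K + 1))) * (L + 1) ≤ ε := by
          rw [← le_div_iff₀ (by positivity)]; exact min_le_left _ _
        have h2 : 0 < min (ε / (L + 1)) (min ρ (h / (K + 1))) := by positivity
        nlinarith
      · intro r z₀ g hs hr0 hrh hg hgK i
        have h1 : min (ε / (L + 1)) (min ρ (h / (K + 1))) * (K + 1) ≤ h := by
          rw [← le_div_iff₀ (by positivity)]
          exact (min_le_right _ _).trans (min_le_right _ _)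
        have h2 : 0 < min (ε / (L + 1)) (min ρ (h / (K + 1))) := by positivity
        obtain ⟨q, hq, hle⟩ := hh r z₀ g hr0 (by nlinarith) hg (by nlinarith) i (-δ) (by
          filter_upwards [hunif (proj z₀) hs i] with z hz hzr
          exact hz ((dist_proj_le z z₀).trans (hzr.trans (hrh.trans
            ((min_le_right _ _).trans (min_le_left _ _))))))
        exact ⟨q, hq, by linarith⟩)
    (fun s s' h h' hgood hss hh0 hhh => by
      refine ⟨(mul_le_mul_of_nonneg_left hhh hL0).trans hgood.1,
        fun r z₀ g hs hr0 hrh hg hgK i => ?_⟩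
      exact hgood.2 r z₀ g (hss.trans hs) hr0 (hrh.trans hhh) hg
        (hgK.trans (mul_le_mul_of_nonneg_right hhh hK0)) i)
  set r : Torus N → ℝ := fun x => χ (f x) with hr
  have hrc : Continuous r := hχc.comp hfc
  have hrA : ∀ x ∈ A, r x = 0 := fun x hx => by simp only [hr, hfzero x hx, hχ0]
  have hrf : ∀ x, 0 ≤ r x ∧ r x ≤ f x ∧ L * r x ≤ ε := by
    intro x
    by_cases hx : x ∈ A
    · rw [hrA x hx, mul_zero]; exact ⟨le_rfl, hf0 x, hε.le⟩
    · obtain ⟨h1, h2, h, hgood, hle, -⟩ := hχ (f x) (hfpos x hx) (hf1 x)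
      exact ⟨h1.le, h2, (mul_le_mul_of_nonneg_left hle hL0).trans hgood.1⟩
  set w := mollifyVec v r with hw
  have hwc : Continuous w := continuous_mollifyVec hv.1 hrc
  have hwv : ∀ x, ‖w x - v x‖ ≤ L * r x := fun x => norm_mollifyVec_sub_le hv.1 hL0 hL (hrf x).1
  have hwA : ∀ x ∈ A, w x = v x := fun x hx => by
    have := hwv x
    rw [hrA x hx, mul_zero] at this
    exact sub_eq_zero.1 (norm_le_zero_iff.1 this)
  have hsmooth : IsSmoothIn w Aᶜ := by
    intro z hz i
    have hpos := hfpos _ hz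
    refine contDiffAt_mollify ((continuous_apply i).comp hv.1) ?_ (hχ _ hpos (hf1 _)).1
    exact ContDiffAt.comp (f := fun z => f (proj z)) z (hχs _ hpos) hfs.contDiffAt
  have hneg : ∀ z, proj z ∈ Aᶜ → ∀ i, ∃ q, HasGradientAt (liftComp w i) q z ∧
      lhs H B w i (proj z) q < 0 := by
    intro z hz
    have hpos := hfpos _ hz
    obtain ⟨h1, h2, h, hgood, hle, hd⟩ := hχ (f (proj z)) hpos (hf1 _)
    have hg := (hfd z).hasGradientAt
    refine hgood.2 r z (deriv χ (f (proj z)) • gradient (fun z => f (proj z)) z) le_rfl h1 hle ?_ ?_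
    · rw [hasGradientAt_iff_hasFDerivAt] at *
      rw [map_smul]
      exact HasDerivAt.comp_hasFDerivAt z
        ((hχs _ hpos).differentiableAt (by simp)).hasDerivAt hg
    · rw [norm_smul, Real.norm_eq_abs]
      exact mul_le_mul hd (hK z _ hg) (norm_nonneg _) ((abs_nonneg _).trans hd)
  refine ⟨w, S.isSubsolution_iff.2 ⟨hwc, fun i z p hp => ?_⟩,
    fun x => (hwv x).trans (hrf x).2.2, hwA, hsmooth,
    S.isStrictIn_of_smooth hwc hA.isOpen_compl hsmooth hneg⟩
  by_cases hz : proj z ∈ A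
  · have hfz := hfzero _ hz
    have hg0 : HasGradientAt (fun z => f (proj z)) 0 z := by
      have hmin : IsLocalMin (fun z => f (proj z)) z :=
        .of_forall fun y => by simpa [hfz] using hf0 (proj y)
      have h1 := (hfd z).hasFDerivAt
      rw [hmin.fderiv_eq_zero] at h1
      rw [hasGradientAt_iff_hasFDerivAt, map_zero]
      exact h1
    -- At a point of `A`, `|w - v| ≤ L * r ≤ L * f`, and `f` vanishes there with zero gradient; the
    -- change is o(|y - z|), so supergradients of `w` are supergradients of `v`.
    have hp' : FrechetSuper (liftComp v i) z p := by
      intro η hη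
      filter_upwards [hp (η / 2) (half_pos hη),
        hg0.eventually_abs_le (ε := η / 2 / (L + 1)) (by positivity)] with y h1 h2
      rw [inner_zero_left, hfz, sub_zero, sub_zero, abs_of_nonneg (hf0 _)] at h2
      have h3 : v (proj y) i - w (proj y) i ≤ L * r (proj y) := by
        have h4 := (norm_le_pi_norm (w (proj y) - v (proj y)) i).trans (hwv (proj y))
        rw [Pi.sub_apply, Real.norm_eq_abs] at h4
        linarith [(abs_le.1 h4).1]
      have h5 : L * r (proj y) ≤ η / 2 * ‖y - z‖ := by
        calc L * r (proj y) ≤ (L + 1) * f (proj y) := by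
              have := hrf (proj y)
              exact mul_le_mul (by linarith) this.2.1 this.1 (by linarith)
          _ ≤ (L + 1) * (η / 2 / (L + 1) * ‖y - z‖) := by gcongr
          _ = η / 2 * ‖y - z‖ := by field_simp
      have h6 : liftComp w i z = liftComp v i z := by simp only [liftComp, hwA _ hz]
      rw [h6] at h1
      simp only [liftComp] at h1 ⊢
      linarith
    have := (S.isSubsolution_iff.1 hv).2 i z p hp'
    simpa only [lhs, hwA _ hz] using this
  · obtain ⟨q, hq, hlt⟩ := hneg z hz i
    rw [hq.eq_of_frechetSuper hp]
    exact hlt.le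

end Smoothing

end WeaklyCoupled

/-! ### Conclusion: existence, approximation and density -/

theorem mainTheorem3 {N m : ℕ}
    (H : Fin m → WeaklyCoupled.Torus N → WeaklyCoupled.Eucl N → ℝ)
    (B : WeaklyCoupled.Torus N → Matrix (Fin m) (Fin m) ℝ)
    (hH : ∀ i, WeaklyCoupled.IsConvexHamiltonian (H i))
    (hBcont : Continuous B)
    (hBcoupling : ∀ x, WeaklyCoupled.IsCoupling (B x))
    (hBirred : ∀ x, WeaklyCoupled.IsIrreducible (B x))
    (hBdeg : ∀ x, WeaklyCoupled.IsDegenerate (B x))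
    (hc : WeaklyCoupled.IsCriticalValue H B 0)
    (k : Fin m) :
    (∃ v ∈ WeaklyCoupled.criticalSubsolutions H B,
      WeaklyCoupled.IsSmoothIn v (WeaklyCoupled.aubrySet H B k)ᶜ ∧
      WeaklyCoupled.IsStrictIn H B v (WeaklyCoupled.aubrySet H B k)ᶜ) ∧
    (∀ v ∈ WeaklyCoupled.criticalSubsolutions H B,
      WeaklyCoupled.IsStrictIn H B v (WeaklyCoupled.aubrySet H B k)ᶜ →
      ∀ ε : ℝ, 0 < ε →
        ∃ w ∈ WeaklyCoupled.criticalSubsolutions H B,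
          ‖w - v‖ < ε ∧
          (∀ x ∈ WeaklyCoupled.aubrySet H B k, w x = v x) ∧
          WeaklyCoupled.IsSmoothIn w (WeaklyCoupled.aubrySet H B k)ᶜ ∧
          WeaklyCoupled.IsStrictIn H B w (WeaklyCoupled.aubrySet H B k)ᶜ) ∧
    WeaklyCoupled.criticalSubsolutions H B ⊆
      closure {w : C(WeaklyCoupled.Torus N, Fin m → ℝ) |
        w ∈ WeaklyCoupled.criticalSubsolutions H B ∧
        WeaklyCoupled.IsSmoothIn w (WeaklyCoupled.aubrySet H B k)ᶜ ∧
        WeaklyCoupled.IsStrictIn H B w (WeaklyCoupled.aubrySet H B k)ᶜ} := by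
  have S : WeaklyCoupled.Admissible H B := ⟨hH, hBcont, hBcoupling, hBirred, hBdeg⟩
  have happrox : ∀ v ∈ WeaklyCoupled.criticalSubsolutions H B,
      WeaklyCoupled.IsStrictIn H B v (WeaklyCoupled.aubrySet H B k)ᶜ →
      ∀ ε : ℝ, 0 < ε →
        ∃ w ∈ WeaklyCoupled.criticalSubsolutions H B,
          ‖w - v‖ < ε ∧
          (∀ x ∈ WeaklyCoupled.aubrySet H B k, w x = v x) ∧
          WeaklyCoupled.IsSmoothIn w (WeaklyCoupled.aubrySet H B k)ᶜ ∧
          WeaklyCoupled.IsStrictIn H B w (WeaklyCoupled.aubrySet H B k)ᶜ := by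
    intro v hv hstrict ε hε
    obtain ⟨w, hw, hwv, hwA, hsmooth, hws⟩ :=
      S.exists_smooth_approx hv (S.isClosed_aubrySet hc k) hstrict (half_pos hε)
    refine ⟨⟨w, hw.1⟩, hw, ?_, hwA, hsmooth, hws⟩
    exact ((ContinuousMap.norm_le _ (half_pos hε).le).2 hwv).trans_lt (half_lt_self hε)
  obtain ⟨v, hv, hstrict⟩ := S.exists_isStrictIn hc k
  refine ⟨?_, happrox, fun u hu => Metric.mem_closure_iff.2 fun ε hε => ?_⟩
  · obtain ⟨w, hw, -, -, hsmooth, hws⟩ := happrox v hv hstrict 1 one_pos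
    exact ⟨w, hw, hsmooth, hws⟩
  -- A weight `t` on the strict subsolution makes the mixture strict while moving `u` by at most `ε
  -- / 2`; smoothing uses the other half.
  · set t : ℝ := min 1 (ε / 2 / (‖v - u‖ + 1)) with ht
    have ht0 : 0 < t := by positivity
    have ht1 : 0 ≤ 1 - t := sub_nonneg.2 (min_le_left _ _)
    have htv : t * ‖v - u‖ ≤ ε / 2 := by
      have : t * (‖v - u‖ + 1) ≤ ε / 2 := by
        rw [← le_div_iff₀ (by positivity)]; exact min_le_right _ _
      nlinarith
    have hmem := S.convex_criticalSubsolutions hu hv ht1 ht0.le (sub_add_cancel 1 t)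
    obtain ⟨w, hw, hwu, -, hsmooth, hws⟩ := happrox ((1 - t) • u + t • v) hmem
      (fun y hy i => S.isStrictCompAt_convex_comb hu (hstrict y hy i) ht1 ht0
        (sub_add_cancel 1 t)) (ε / 2) (half_pos hε)
    refine ⟨w, ⟨hw, hsmooth, hws⟩, ?_⟩
    have h1 : u - w = -(t • (v - u)) - (w - ((1 - t) • u + t • v)) := by module
    rw [dist_eq_norm, h1]
    refine (norm_sub_le _ _).trans_lt ?_
    rw [norm_neg, norm_smul, Real.norm_of_nonneg ht0.le]
    linarith
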